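/- Conventions. A search problem $S\subseteq\{0,1\}^V\times\mathcal O$ asks, on input $x$, for some $o$ with $(x,o)\in S$. For a family $\mathcal F$ of subsets of $\{0,1\}^V$, an $\mathcal F$-tree solving $S$ is a finite rooted tree with at most two children per vertex, each vertex $v$ carrying a set $f_v\in\mathcal F$, such that $f_{\mathrm{root}}=\{0,1\}^V$, the set $f_v$ of a non-leaf $v$ is contained in the union of the sets of its children, and for each leaf $v$ some single $o$ is a correct output for all $x\in f_v$. Its size is its number of vertices. Decision trees are the $\mathcal F$-trees with $\mathcal F$ the conjunctions of literals, LTF-trees those with $\mathcal F$ the linear threshold functions; $\mathrm{decTree}(S)$ and $\mathrm{ltfTree}(S)$ denote the least sizes of such trees solving $S$, and $\mathrm d(S)$ the least depth of a decision tree solving $S$. For an unsatisfiable CNF formula $F$, $S_F$ is the problem of finding a clause of $F$ falsified by a given assignment, and $\mathrm d(F)=\mathrm d(S_F)$ is the Resolution depth of $F$. $\mathrm{resTree}(F)$ is the least length of a tree-like Resolution refutation of $F$, and $\mathrm{cutTree}(F)$ the least length of a tree-like Cutting Planes refutation of $F$ with the semantic rule (any inequality implied on $\{0,1\}^V$ by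 at most two premises). For $m\ge 2$, the index gadget is $\mathrm{Ind}_m\colon[m]\times\{0,1\}^m\to\{0,1\}$, $\mathrm{Ind}_m(x,y)=y_x$, where the elements of $[m]$ are encoded by strings of $\lceil\log_2 m\rceil$ bits: every string denotes an element of $[m]$, and every element is denoted by at least one string (if $m$ is a power of two, the encoding is a bijection). For an $n$-variate $F$, $S_F\circ\mathrm{Ind}_m^n$ is the search problem obtained by replacing each variable by its own copy of the gadget. $F\circ\mathrm{Ind}_m^n$ is the CNF formula that lists, for every clause $D$ of $F$ and every choice of pointer strings for the variables of $D$, the negation of the certificate that fixes these pointers and fixes the pointed-to bits so that all literals of $D$ are false. Theorem. There are absolute constants $c,C>0$ such that for every $m\ge2$ (and every such encoding of $[m]$) the gadget $\mathrm{Ind}_m$ has decision-tree query complexity at most $C\log m$, and for every $n$ and every unsatisfiable CNF formula $F$ in $n$ variables $$m^{c\cdot\min(\mathrm d(F),\,m^{1/1000})}\;\le\;\mathrm{ltfTree}(S_F\circ\mathrm{Ind}_m^n)\;\le\;\mathrm{decTree}(S_F\circ\mathrm{Ind}_m^n)\;\le\;m^{C\cdot\mathrm d(F)}$$ and $$m^{c\cdot\min(\mathrm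 d(F),\,m^{1/1000})}\;\le\;\mathrm{cutTree}(F\circ\mathrm{Ind}_m^n)\;\le\;\mathrm{resTree}(F\circ\mathrm{Ind}_m^n)\;\le\;m^{C\cdot\mathrm d(F)}.$$ -/

import Mathlib

namespace LiftCP

/-! ### Clauses, CNF formulas, search problems -/

/-- A literal over the variables `V`: `(v, true)` is `v` and `(v, false)` is its negation.
The literal `l` is true under `x : V → Bool` iff `x l.1 = l.2`. -/
abbrev Literal (V : Type) := V × Bool

/-- A clause: the disjunction of a finite set of literals. -/
abbrev Clause (V : Type) := Finset (Literal V)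

/-- A CNF formula: the conjunction of a finite set of clauses. -/
abbrev CNF (V : Type) := Finset (Clause V)

/-- The assignment `x` makes every literal of the clause `D` false. -/
def Clause.Falsified {V : Type} (D : Clause V) (x : V → Bool) : Prop :=
  ∀ l ∈ D, x l.1 ≠ l.2

/-- Every assignment falsifies some clause of `F`. -/
def CNF.Unsat {V : Type} (F : CNF V) : Prop :=
  ∀ x : V → Bool, ∃ D ∈ F, Clause.Falsified D x

/-- A search problem `S ⊆ I × O`: on input `x`, find an `o` with `S x o`. -/
abbrev SearchProblem (I O : Type) := I → O → Prop

/-- The falsified-clause search problem of `F`: given an assignment, find a falsified clause. -/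
def CNF.search {V : Type} (F : CNF V) : SearchProblem (V → Bool) {D : Clause V // D ∈ F} :=
  fun x D => Clause.Falsified D.1 x

/-- Composition of a search problem over the variables `V` with a gadget `g` on the bits `W`:
each variable `v` is replaced by `g` applied to its own block of variables `(v, w)`, `w : W`. -/
def SearchProblem.comp {V W O : Type} (S : SearchProblem (V → Bool) O)
    (g : (W → Bool) → Bool) : SearchProblem (V × W → Bool) O :=
  fun u o => S (fun v => g fun w => u (v, w)) o

/-! ### Trees solving search problems -/

/-- Finite rooted trees of out-degree at most two whose vertices are labelled with feasible sets
(subsets of `I`).  A vertex with one child is a vertex whose two children coincide. -/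
inductive FeasTree (I : Type) : Type
  | leaf (f : Set I) : FeasTree I
  | node₁ (f : Set I) (t : FeasTree I) : FeasTree I
  | node₂ (f : Set I) (t₁ t₂ : FeasTree I) : FeasTree I

namespace FeasTree

variable {I O : Type}

/-- The feasible set at the root. -/
def root : FeasTree I → Set I
  | leaf f => f
  | node₁ f _ => f
  | node₂ f _ _ => f

/-- The number of vertices. -/
def size : FeasTree I → ℕ
  | leaf _ => 1
  | node₁ _ t => t.size + 1
  | node₂ _ t₁ t₂ => t₁.size + t₂.size + 1

/-- The number of edges on a longest root-to-leaf path. -/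
def depth : FeasTree I → ℕ
  | leaf _ => 0
  | node₁ _ t => t.depth + 1
  | node₂ _ t₁ t₂ => max t₁.depth t₂.depth + 1

/-- All feasible sets belong to the family `𝓕`, the feasible set of an inner vertex is covered by
those of its children, and at each leaf one output is correct on the whole feasible set. -/
def Valid (𝓕 : Set (Set I)) (S : SearchProblem I O) : FeasTree I → Prop
  | leaf f => f ∈ 𝓕 ∧ ∃ o, ∀ x ∈ f, S x o
  | node₁ f t => f ∈ 𝓕 ∧ f ⊆ t.root ∧ t.Valid 𝓕 S
  | node₂ f t₁ t₂ => f ∈ 𝓕 ∧ f ⊆ t₁.root ∪ t₂.root ∧ t₁.Valid 𝓕 S ∧ t₂.Valid 𝓕 S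

/-- The tree is an `𝓕`-tree solving `S`. -/
def Solves (t : FeasTree I) (𝓕 : Set (Set I)) (S : SearchProblem I O) : Prop :=
  t.root = Set.univ ∧ t.Valid 𝓕 S

end FeasTree

/-- The sets of satisfying assignments of conjunctions of literals. -/
def conjunctions (V : Type) : Set (Set (V → Bool)) :=
  {f | ∃ C : Finset (Literal V), f = {x | ∀ l ∈ C, x l.1 = l.2}}

/-- The sets accepted by linear threshold functions. -/
def thresholds (V : Type) [Fintype V] : Set (Set (V → Bool)) :=
  {f | ∃ (a : V → ℝ) (b : ℝ), f = {x | b ≤ ∑ v, if x v then a v else 0}}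

/-- The least size of a decision tree (a tree of conjunctions) solving `S`. -/
noncomputable def decTree {V O : Type} (S : SearchProblem (V → Bool) O) : ℕ :=
  sInf {s | ∃ t : FeasTree (V → Bool), t.Solves (conjunctions V) S ∧ t.size = s}

/-- The least size of an LTF-tree solving `S`. -/
noncomputable def ltfTree {V O : Type} [Fintype V] (S : SearchProblem (V → Bool) O) : ℕ :=
  sInf {s | ∃ t : FeasTree (V → Bool), t.Solves (thresholds V) S ∧ t.size = s}

/-- The least depth of a decision tree solving `S`. -/
noncomputable def decDepth {V O : Type} (S : SearchProblem (V → Bool) O) : ℕ :=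
  sInf {s | ∃ t : FeasTree (V → Bool), t.Solves (conjunctions V) S ∧ t.depth = s}

/-- The query complexity of a Boolean function: the least depth of a decision tree computing it. -/
noncomputable def queryComplexity {W : Type} (g : (W → Bool) → Bool) : ℕ :=
  decDepth (fun (u : W → Bool) (b : Bool) => g u = b)

/-! ### Tree-like Resolution and tree-like Cutting Planes -/

/-- `TreeRes F D L`: the clause `D` has a tree-like Resolution derivation from `F` with exactly
`L` lines. -/
inductive TreeRes {V : Type} [DecidableEq V] (F : CNF V) : Clause V → ℕ → Prop
  | initial (D : Clause V) (h : D ∈ F) : TreeRes F D 1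
  | resolve (v : V) (A B : Clause V) (L₁ L₂ : ℕ)
      (h₁ : TreeRes F (insert (v, true) A) L₁) (h₂ : TreeRes F (insert (v, false) B) L₂) :
      TreeRes F (A ∪ B) (L₁ + L₂ + 1)

/-- The least length of a tree-like Resolution refutation of `F`. -/
noncomputable def resTree {V : Type} [DecidableEq V] (F : CNF V) : ℕ :=
  sInf {L | TreeRes F ∅ L}

/-- The linear inequality `∑ v, a v * x v ≥ b` with integer coefficients. -/
structure Line (V : Type) where
  /-- The coefficients. -/
  a : V → ℤ
  /-- The right-hand side. -/
  b : ℤ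

/-- The Boolean vector `x` satisfies the inequality. -/
def Line.Holds {V : Type} [Fintype V] (ℓ : Line V) (x : V → Bool) : Prop :=
  ℓ.b ≤ ∑ v, if x v then ℓ.a v else 0

/-- The encoding of a clause as `∑_{(v, true) ∈ D} x v + ∑_{(v, false) ∈ D} (1 - x v) ≥ 1`. -/
def Clause.toLine {V : Type} [DecidableEq V] (D : Clause V) : Line V where
  a v := (if (v, true) ∈ D then 1 else 0) - (if (v, false) ∈ D then 1 else 0)
  b := 1 - ((D.filter fun l => l.2 = false).card : ℤ)

/-- `TreeCut F ℓ L`: the inequality `ℓ` has a tree-like semantic Cutting Planes derivation from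
`F` with exactly `L` lines. -/
inductive TreeCut {V : Type} [Fintype V] [DecidableEq V] (F : CNF V) : Line V → ℕ → Prop
  | nonneg (v : V) : TreeCut F ⟨fun w => if w = v then 1 else 0, 0⟩ 1
  | le_one (v : V) : TreeCut F ⟨fun w => if w = v then -1 else 0, -1⟩ 1
  | initial (D : Clause V) (h : D ∈ F) : TreeCut F D.toLine 1
  | infer₁ (ℓ₁ ℓ : Line V) (L₁ : ℕ) (h₁ : TreeCut F ℓ₁ L₁)
      (h : ∀ x, ℓ₁.Holds x → ℓ.Holds x) : TreeCut F ℓ (L₁ + 1)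
  | infer₂ (ℓ₁ ℓ₂ ℓ : Line V) (L₁ L₂ : ℕ) (h₁ : TreeCut F ℓ₁ L₁) (h₂ : TreeCut F ℓ₂ L₂)
      (h : ∀ x, ℓ₁.Holds x → ℓ₂.Holds x → ℓ.Holds x) : TreeCut F ℓ (L₁ + L₂ + 1)

/-- The least length of a tree-like semantic Cutting Planes refutation of `F`, that is, of a
derivation of `0 ≥ 1`. -/
noncomputable def cutTree {V : Type} [Fintype V] [DecidableEq V] (F : CNF V) : ℕ :=
  sInf {L | TreeCut F ⟨fun _ => 0, 1⟩ L}

/-! ### The index gadget -/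

/-- The number of bits used to write an element of `[m]`, the rounded-up binary logarithm. -/
abbrev ptrBits (m : ℕ) : ℕ := Nat.clog 2 m

/-- The input bits of the index gadget: the pointer bits and the `m` cells of the vector. -/
abbrev IndVar (m : ℕ) : Type := Fin (ptrBits m) ⊕ Fin m

/-- The index gadget `(x, y) ↦ y_x`, the pointer `x ∈ [m]` being given by a bit string that is
read through `dec`. -/
def indGadget {m : ℕ} (dec : (Fin (ptrBits m) → Bool) → Fin m) (u : IndVar m → Bool) : Bool :=
  u (Sum.inr (dec fun j => u (Sum.inl j)))

/-- The negation of the certificate that, for each variable `v` of the clause `D`, fixes the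
pointer of the gadget of `v` to `p v` and the pointed-to bit so that its literal in `D` is
false. -/
def Clause.liftInd {V : Type} [DecidableEq V] {m : ℕ} (dec : (Fin (ptrBits m) → Bool) → Fin m)
    (D : Clause V) (p : V → Fin (ptrBits m) → Bool) : Clause (V × IndVar m) :=
  D.biUnion fun l =>
    (Finset.univ.image fun j => ((l.1, Sum.inl j), !(p l.1 j))) ∪
      {((l.1, Sum.inr (dec (p l.1))), l.2)}

/-- The CNF formula obtained from `F` by composing with the index gadget: it lists the clauses
`D.liftInd dec p` for all clauses `D` of `F` and all pointer values `p`. -/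
def CNF.compInd {V : Type} [Fintype V] [DecidableEq V] {m : ℕ} (F : CNF V)
    (dec : (Fin (ptrBits m) → Bool) → Fin m) : CNF (V × IndVar m) :=
  F.biUnion fun D => Finset.univ.image fun p => D.liftInd dec p

end LiftCP

open LiftCP

open LiftCP

set_option linter.unusedSectionVars false

/-! Everything except the lower bound for LTF-trees is simulation. A query to a variable of `F`
becomes `ptrBits m + 1` queries to its gadget (`Solv.compInd`). A decision tree for the
falsified-clause problem unfolds into a tree-like Resolution refutation, whose clauses are also
Cutting Planes lines. The negated lines of a Cutting Planes refutation form an LTF-tree, and a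
falsified lifted clause names a falsified clause of `F`. So one lower bound serves both chains.

For that bound, split an input into pointers `x` and vectors `y`. A threshold query has the form `t
≤ A x + B y`, hence is constant on half of the pointers times half of the vectors
(`exists_constant_quarter`). An adversary keeps a large rectangle `X × Y` on which the gadgets of a
set `I` are answered by `z`, where `z` on `I` is a subcube still hard for `F`, and `X` is blockwise
dense outside `I`. After a query, `exists_spread_parts` cuts most of `X` into dense parts at the
price of fixing further blocks; the hardness of `F` dictates the answers in these blocks. Enforcing
them is possible because a dense `Y` has little Fourier weight on low levels (`level_le`, from
hypercontractivity) while a spread `x` rarely hits a given character: for some `x`, the cells it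
points to are almost unbiased on `Y` (`exists_compatible`).

Each query costs `X` a factor 4, and each fixed block wins back a factor `κ = √m`. Hence `q` queries
fix only `O(q / log m)` blocks, and the adversary survives for `q` of order `d log m`, as long as
`κ` exceeds a constant times `q²`; this is where the cap on the exponent comes from. Querying
balanced separators of a tree turns survival for `q` queries into size `(4/3)^q`, whatever the depth
(`FeasTree.pow_le_size`). -/

namespace LiftCP

/-! ### Decision trees on subcubes -/

/-- `Solv S k I z`: the subcube of all `x` that agree with `z` on `I` is solved by a decision tree
of depth at most `k` that queries one variable per inner vertex. -/
def Solv {V O : Type} [DecidableEq V] (S : SearchProblem (V → Bool) O) :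
    ℕ → Finset V → (V → Bool) → Prop
  | 0, I, z => ∃ o, ∀ x : V → Bool, (∀ v ∈ I, x v = z v) → S x o
  | k + 1, I, z => Solv S k I z ∨ ∃ v, ∀ b, Solv S k (insert v I) (Function.update z v b)

namespace Solv

variable {V O : Type} [DecidableEq V] {S : SearchProblem (V → Bool) O}

theorem mono_depth {k l : ℕ} (h : k ≤ l) {I : Finset V} {z : V → Bool} (hs : Solv S k I z) :
    Solv S l I z := by
  induction h with
  | refl => exact hs
  | step _ ih => exact Or.inl ih

theorem mono_cube {k : ℕ} : ∀ {I J : Finset V} {z w : V → Bool}, I ⊆ J → (∀ v ∈ I, w v = z v) →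
    Solv S k I z → Solv S k J w := by
  induction k with
  | zero =>
    rintro I J z w hIJ hw ⟨o, ho⟩
    exact ⟨o, fun x hx => ho x fun v hv => (hx v (hIJ hv)).trans (hw v hv)⟩
  | succ k ih =>
    rintro I J z w hIJ hw (h | ⟨v, hv⟩)
    · exact Or.inl (ih hIJ hw h)
    · refine Or.inr ⟨v, fun b => ih (Finset.insert_subset_insert v hIJ) ?_ (hv b)⟩
      intro u hu
      by_cases huv : u = v
      · subst huv; simp
      · simp only [Function.update_of_ne huv]
        exact hw u (by simpa [huv] using hu)

/-- Querying all variables of `Q`. -/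
theorem query {k : ℕ} (Q : Finset V) : ∀ {I : Finset V} {z : V → Bool},
    (∀ w : V → Bool, (∀ v ∈ I, v ∉ Q → w v = z v) → Solv S k (I ∪ Q) w) →
      Solv S (k + Q.card) I z := by
  induction Q using Finset.induction_on with
  | empty => intro I z h; simpa using h z (by simp)
  | insert v Q hv ih =>
    intro I z h
    rw [Finset.card_insert_of_notMem hv, ← Nat.add_assoc]
    refine Or.inr ⟨v, fun b => ih fun w hw => ?_⟩
    have := h w ?_
    · simpa [Finset.insert_union, Finset.union_insert] using this
    · intro u hu huQ
      simp only [Finset.mem_insert, not_or] at huQ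
      simpa [huQ.1] using hw u (by simp [hu]) huQ.2

theorem query_one {k : ℕ} (a : V) {I : Finset V} {z : V → Bool}
    (h : ∀ w : V → Bool, (∀ v ∈ I, v ≠ a → w v = z v) → Solv S k (I ∪ {a}) w) :
    Solv S (k + 1) I z := by
  simpa using query {a} (I := I) (z := z) (fun w hw => h w fun v hv hva => hw v hv (by simpa))

theorem map_output {O' : Type} {S' : SearchProblem (V → Bool) O'} (e : O → O')
    (he : ∀ x o, S x o → S' x (e o)) {k : ℕ} : ∀ {I : Finset V} {z : V → Bool},
      Solv S k I z → Solv S' k I z := by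
  induction k with
  | zero => rintro I z ⟨o, ho⟩; exact ⟨e o, fun x hx => he _ _ (ho x hx)⟩
  | succ k ih =>
    rintro I z (h | ⟨v, hv⟩)
    · exact Or.inl (ih h)
    · exact Or.inr ⟨v, fun b => ih (hv b)⟩

/-- An adversary who keeps a subcube hard can answer any set of queries. -/
theorem exists_hard_answers {k : ℕ} (Q : Finset V) {I : Finset V} {z : V → Bool}
    (hQ : Disjoint Q I) (h : ¬ Solv S (k + Q.card) I z) :
    ∃ w : V → Bool, (∀ v ∈ I, w v = z v) ∧ ¬ Solv S k (I ∪ Q) w := by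
  by_contra! hc
  exact h (query Q fun w hw => hc w fun v hv => hw v hv fun hvQ =>
    Finset.disjoint_left.1 hQ hvQ hv)

end Solv

/-- The conjunction describing the subcube of all `x` that agree with `z` on `I`. -/
theorem cube_mem_conjunctions {V : Type} [DecidableEq V] (I : Finset V) (z : V → Bool) :
    {x : V → Bool | ∀ v ∈ I, x v = z v} ∈ conjunctions V := by
  refine ⟨I.image fun v => (v, z v), ?_⟩
  ext x; simp

theorem FeasTree.one_le_size {I : Type} (t : FeasTree I) : 1 ≤ t.size := by
  cases t <;> simp [FeasTree.size]

/-- A full binary tree of depth `k` has `2 ^ (k + 1) - 1` vertices; the `+ 1` on the left avoids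
subtraction in the induction. -/
theorem Solv.exists_tree {V O : Type} [DecidableEq V] {S : SearchProblem (V → Bool) O} {k : ℕ} :
    ∀ {I : Finset V} {z : V → Bool}, Solv S k I z →
      ∃ t : FeasTree (V → Bool), t.root = {x | ∀ v ∈ I, x v = z v} ∧
        t.Valid (conjunctions V) S ∧ t.depth ≤ k ∧ t.size + 1 ≤ 2 ^ (k + 1) := by
  induction k with
  | zero =>
    rintro I z ⟨o, ho⟩
    exact ⟨.leaf _, rfl, ⟨cube_mem_conjunctions I z, o, ho⟩, by simp [FeasTree.depth],
      by simp [FeasTree.size]⟩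
  | succ k ih =>
    rintro I z (h | ⟨v, hv⟩)
    · obtain ⟨t, h1, h2, h3, h4⟩ := ih h
      exact ⟨t, h1, h2, by omega, by rw [pow_succ]; omega⟩
    · obtain ⟨t, h1, h2, h3, h4⟩ := ih (hv false)
      obtain ⟨t', h1', h2', h3', h4'⟩ := ih (hv true)
      refine ⟨.node₂ {x | ∀ v ∈ I, x v = z v} t t', rfl,
        ⟨cube_mem_conjunctions I z, ?_, h2, h2'⟩, by simp [FeasTree.depth, h3, h3'], ?_⟩
      · rw [h1, h1']
        intro x hx
        have key : ∀ b, x v = b → ∀ u ∈ insert v I, x u = Function.update z v b u := by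
          intro b hb u hu
          by_cases huv : u = v
          · subst huv; simpa using hb
          · simpa [huv] using hx u (by simpa [huv] using hu)
        cases hb : x v
        · exact Or.inl (key _ hb)
        · exact Or.inr (key _ hb)
      · simp only [FeasTree.size]
        rw [pow_succ]; omega

/-- Trees of conjunctions are decision trees: if two subcubes cover a third one, then one of them
contains it or they contain the two halves of it in some direction. -/
theorem Solv.of_tree {V O : Type} [DecidableEq V] {S : SearchProblem (V → Bool) O}
    (t : FeasTree (V → Bool)) : t.Valid (conjunctions V) S → ∀ {I : Finset V} {z : V → Bool},
      {x | ∀ v ∈ I, x v = z v} ⊆ t.root → Solv S t.depth I z := by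
  induction t with
  | leaf f =>
    rintro ⟨-, o, ho⟩ I z hI
    exact ⟨o, fun x hx => ho x (hI hx)⟩
  | node₁ f t ih =>
    rintro ⟨-, hf, ht⟩ I z hI
    exact Or.inl (ih ht (hI.trans hf))
  | node₂ f t₁ t₂ ih₁ ih₂ =>
    rintro ⟨-, hf, ht₁, ht₂⟩ I z hI
    have hcov := hI.trans hf
    have hk₁ : t₁.depth ≤ max t₁.depth t₂.depth := le_max_left _ _
    have hk₂ : t₂.depth ≤ max t₁.depth t₂.depth := le_max_right _ _
    change Solv S (max t₁.depth t₂.depth + 1) I z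
    by_cases h₁ : {x | ∀ v ∈ I, x v = z v} ⊆ t₁.root
    · exact Or.inl ((ih₁ ht₁ h₁).mono_depth hk₁)
    by_cases h₂ : {x | ∀ v ∈ I, x v = z v} ⊆ t₂.root
    · exact Or.inl ((ih₂ ht₂ h₂).mono_depth hk₂)
    have hr : ∀ t : FeasTree (V → Bool), t.Valid (conjunctions V) S → t.root ∈ conjunctions V := by
      rintro (_ | _ | _) h <;> exact h.1
    obtain ⟨C₁, hC₁⟩ := hr t₁ ht₁
    obtain ⟨C₂, hC₂⟩ := hr t₂ ht₂
    rw [hC₁] at h₁ hcov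
    rw [hC₂] at h₂ hcov
    rw [Set.not_subset] at h₁ h₂
    obtain ⟨x₁, hx₁, hx₁'⟩ := h₁
    obtain ⟨x₂, hx₂, hx₂'⟩ := h₂
    simp only [Set.mem_ofPred_eq, not_forall] at hx₁ hx₁' hx₂ hx₂'
    obtain ⟨⟨v, b⟩, hb, hvb⟩ := hx₁'
    obtain ⟨⟨w, c⟩, hc, hwc⟩ := hx₂'
    simp only at hvb hwc
    -- From each child comes one literal that fails somewhere on the subcube, yet no point of the
    -- subcube fails both. This forces complementary literals of one free variable, which is the
    -- variable to query.
    have hsub : ∀ x : V → Bool, (∀ v ∈ I, x v = z v) → x v = b ∨ x w = c := by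
      intro x hx
      rcases hcov hx with h | h
      · exact Or.inl (h _ hb)
      · exact Or.inr (h _ hc)
    have hgen : ∀ (C : Finset (Literal V)) (u : V) (a : Bool), (u, a) ∈ C →
        ∀ x : V → Bool, x u ≠ a → x ∉ {x : V → Bool | ∀ l ∈ C, x l.1 = l.2} :=
      fun C u a hu x hxu hx => hxu (hx _ hu)
    by_cases hv : v ∈ I
    · exfalso
      have : x₂ w = c := (hsub x₂ hx₂).resolve_left (by rw [hx₂ v hv, ← hx₁ v hv]; exact hvb)
      exact hwc this
    by_cases hw : w ∈ I
    · exfalso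
      have : x₁ v = b := (hsub x₁ hx₁).resolve_right (by rw [hx₁ w hw, ← hx₂ w hw]; exact hwc)
      exact hvb this
    have hwv : w = v ∧ c = !b := by
      by_cases hwv : w = v
      · subst hwv
        refine ⟨rfl, ?_⟩
        by_contra hcb
        have hcb : c = b := by revert hcb; cases b <;> cases c <;> simp
        subst hcb
        rcases hsub x₂ hx₂ with h | h <;> exact hwc h
      · exfalso
        rcases hsub (Function.update (Function.update z v (!b)) w (!c)) (by
          intro u hu
          rw [Function.update_of_ne (by rintro rfl; exact hw hu),
            Function.update_of_ne (by rintro rfl; exact hv hu)]) with h | h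
        · rw [Function.update_of_ne (Ne.symm hwv)] at h; simp at h
        · simp at h
    obtain ⟨rfl, rfl⟩ := hwv
    have hmem : ∀ a (x : V → Bool), (∀ u ∈ insert w I, x u = Function.update z w a u) →
        x w = a ∧ ∀ u ∈ I, x u = z u := by
      intro a x hx
      refine ⟨by simpa using hx w (by simp), fun u hu => ?_⟩
      simpa [show u ≠ w by rintro rfl; exact hw hu] using hx u (by simp [hu])
    have hA : Solv S (max t₁.depth t₂.depth) (insert w I) (Function.update z w b) := by
      refine (ih₁ ht₁ fun x hx => ?_).mono_depth hk₁
      obtain ⟨hxw, hxI⟩ := hmem _ _ hx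
      rw [hC₁]
      exact (hcov hxI).resolve_right (hgen _ _ _ hc x (by simp [hxw]))
    have hB : Solv S (max t₁.depth t₂.depth) (insert w I) (Function.update z w (!b)) := by
      refine (ih₂ ht₂ fun x hx => ?_).mono_depth hk₂
      obtain ⟨hxw, hxI⟩ := hmem _ _ hx
      rw [hC₂]
      exact (hcov hxI).resolve_left (hgen _ _ _ hb x (by simp [hxw]))
    refine Or.inr ⟨w, fun a => ?_⟩
    by_cases hab : a = b
    · exact hab ▸ hA
    · rw [show a = !b by revert hab; cases a <;> cases b <;> simp]; exact hB

theorem Solv.decDepth_le {V O : Type} [DecidableEq V] {S : SearchProblem (V → Bool) O} {k : ℕ}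
    {z : V → Bool} (h : Solv S k ∅ z) : decDepth S ≤ k := by
  obtain ⟨t, h1, h2, h3, -⟩ := h.exists_tree
  exact (Nat.sInf_le ⟨t, ⟨by simpa using h1, h2⟩, rfl⟩ : decDepth S ≤ _).trans h3

theorem Solv.exists_decTree {V O : Type} [DecidableEq V] {S : SearchProblem (V → Bool) O} {k : ℕ}
    {z : V → Bool} (h : Solv S k ∅ z) :
    ∃ t : FeasTree (V → Bool), t.Solves (conjunctions V) S ∧ t.size + 1 ≤ 2 ^ (k + 1) := by
  obtain ⟨t, h1, h2, -, h4⟩ := h.exists_tree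
  exact ⟨t, ⟨by simpa using h1, h2⟩, h4⟩

theorem Solv.decTree_le {V O : Type} [DecidableEq V] {S : SearchProblem (V → Bool) O} {k : ℕ}
    {z : V → Bool} (h : Solv S k ∅ z) : decTree S + 1 ≤ 2 ^ (k + 1) := by
  obtain ⟨t, h1, h2⟩ := h.exists_decTree
  exact le_trans (by gcongr; exact Nat.sInf_le ⟨t, h1, rfl⟩) h2

theorem CNF.Unsat.solv_card {V : Type} [Fintype V] [DecidableEq V] {F : CNF V} (hF : F.Unsat)
    (z : V → Bool) : Solv F.search (Fintype.card V) ∅ z := by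
  have := Solv.query (S := F.search) (k := 0) (Finset.univ : Finset V) (I := ∅) (z := z)
    (fun w _ => by
      obtain ⟨D, hD, hDw⟩ := hF w
      refine ⟨⟨D, hD⟩, fun x hx => ?_⟩
      rwa [show x = w from funext fun v => hx v (by simp)])
  simpa using this

/-- Querying all variables solves the problem, so the infimum defining `decDepth` ranges over a
nonempty set and is attained. -/
theorem CNF.Unsat.solv_decDepth {V : Type} [Fintype V] [DecidableEq V] {F : CNF V}
    (hF : F.Unsat) (z : V → Bool) : Solv F.search (decDepth F.search) ∅ z := by
  obtain ⟨t, ⟨h1, h2⟩, h3⟩ := Nat.sInf_mem (s := {s | ∃ t : FeasTree (V → Bool),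
    t.Solves (conjunctions V) F.search ∧ t.depth = s}) (by
      obtain ⟨t, h1, h2, -, -⟩ := (hF.solv_card z).exists_tree
      exact ⟨_, t, ⟨by simpa using h1, h2⟩, rfl⟩)
  have := Solv.of_tree t h2 (I := ∅) (z := z) (by rw [h1]; exact Set.subset_univ _)
  rw [h3] at this
  exact this

/-! ### Composition with the index gadget -/

section Index

variable {V : Type} [DecidableEq V] {m : ℕ} (dec : (Fin (ptrBits m) → Bool) → Fin m)

/-- The variables read by the gadgets of `I` on the input `u`. -/
def readVars (I : Finset V) (u : V × IndVar m → Bool) : Finset (V × IndVar m) :=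
  I.biUnion fun v => (Finset.univ.image fun j => (v, Sum.inl j)) ∪
    {(v, Sum.inr (dec fun j => u (v, Sum.inl j)))}

theorem mem_readVars {I : Finset V} {u : V × IndVar m → Bool} {a : V × IndVar m} :
    a ∈ readVars dec I u ↔ a.1 ∈ I ∧
      ((∃ j, a.2 = Sum.inl j) ∨ a.2 = Sum.inr (dec fun j => u (a.1, Sum.inl j))) := by
  obtain ⟨v, w⟩ := a
  simp only [readVars, Finset.mem_biUnion, Finset.mem_union, Finset.mem_image, Finset.mem_univ,
    true_and, Finset.mem_singleton, Prod.mk.injEq]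
  constructor
  · rintro ⟨v', hv', ⟨j, rfl, rfl⟩ | ⟨rfl, rfl⟩⟩
    · exact ⟨hv', Or.inl ⟨j, rfl⟩⟩
    · exact ⟨hv', Or.inr rfl⟩
  · rintro ⟨hv, ⟨j, rfl⟩ | rfl⟩
    · exact ⟨v, hv, Or.inl ⟨j, rfl, rfl⟩⟩
    · exact ⟨v, hv, Or.inr ⟨rfl, rfl⟩⟩

theorem Clause.mem_liftInd {D : Clause V} {p : V → Fin (ptrBits m) → Bool}
    {a : Literal (V × IndVar m)} : a ∈ D.liftInd dec p ↔
      (∃ l ∈ D, ∃ j, a = ((l.1, Sum.inl j), !(p l.1 j))) ∨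
        ∃ l ∈ D, a = ((l.1, Sum.inr (dec (p l.1))), l.2) := by
  simp only [Clause.liftInd, Finset.mem_biUnion, Finset.mem_union, Finset.mem_image,
    Finset.mem_univ, true_and, Finset.mem_singleton]
  constructor
  · rintro ⟨l, hl, ⟨j, rfl⟩ | rfl⟩
    · exact Or.inl ⟨l, hl, j, rfl⟩
    · exact Or.inr ⟨l, hl, rfl⟩
  · rintro (⟨l, hl, j, rfl⟩ | ⟨l, hl, rfl⟩)
    · exact ⟨l, hl, Or.inl ⟨j, rfl⟩⟩
    · exact ⟨l, hl, Or.inr rfl⟩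

/-- The pointer literals force the actual pointers to be `p`, so the last literal of each block
speaks about the gadget's value. This is what carries lower bounds from the composed search problem
to the composed formula. -/
theorem Clause.falsified_of_liftInd {D : Clause V} {p : V → Fin (ptrBits m) → Bool}
    {u : V × IndVar m → Bool} (h : (D.liftInd dec p).Falsified u) :
    D.Falsified fun v => indGadget dec fun w => u (v, w) := by
  intro l hl
  have h1 : (fun j => u (l.1, Sum.inl j)) = p l.1 := by
    funext j
    have := h _ ((Clause.mem_liftInd dec).2 (Or.inl ⟨l, hl, j, rfl⟩))
    revert this; simp
  have h2 := h _ ((Clause.mem_liftInd dec).2 (Or.inr ⟨l, hl, rfl⟩))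
  simpa [indGadget, h1] using h2

variable [Fintype V]

theorem CNF.mem_compInd {F : CNF V} {E : Clause (V × IndVar m)} :
    E ∈ F.compInd dec ↔ ∃ D ∈ F, ∃ p, D.liftInd dec p = E := by
  simp [CNF.compInd]

/-- A decision tree for `F` yields one for the composed formula. -/
theorem Solv.compInd {F : CNF V} {k : ℕ} : ∀ {I : Finset V} {z : V → Bool},
    Solv F.search k I z → ∀ u : V × IndVar m → Bool,
      (∀ v ∈ I, indGadget dec (fun w => u (v, w)) = z v) →
        Solv (F.compInd dec).search (k * (ptrBits m + 1)) (readVars dec I u) u := by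
  induction k with
  | zero =>
    rintro I z ⟨D, hD⟩ u hu
    rw [Nat.zero_mul]
    refine ⟨⟨D.1.liftInd dec fun v j => u (v, Sum.inl j),
      (CNF.mem_compInd dec).2 ⟨D.1, D.2, _, rfl⟩⟩, fun x hx => ?_⟩
    -- A clause falsified on a whole subcube has all its variables fixed: a free literal could be
    -- made true.
    have hDI : ∀ l ∈ D.1, l.1 ∈ I ∧ z l.1 ≠ l.2 := by
      intro l hl
      have hlI : l.1 ∈ I := by
        by_contra hlI
        have h1 := hD (Function.update z l.1 l.2) (fun v hv => by
          rw [Function.update_of_ne]; rintro rfl; exact hlI hv) l hl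
        simp at h1
      exact ⟨hlI, hD z (fun _ _ => rfl) l hl⟩
    change Clause.Falsified (D.1.liftInd dec fun v j => u (v, Sum.inl j)) x
    intro a ha
    rcases (Clause.mem_liftInd dec).1 ha with ⟨l, hl, j, rfl⟩ | ⟨l, hl, rfl⟩
    · have := hx (l.1, Sum.inl j) ((mem_readVars dec).2 ⟨(hDI l hl).1, Or.inl ⟨j, rfl⟩⟩)
      simp only [this]; simp
    · have := hx (l.1, Sum.inr (dec fun j => u (l.1, Sum.inl j))) ((mem_readVars dec).2 ⟨(hDI l hl).1, Or.inr rfl⟩)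
      simp only [this]
      have h2 := hu _ (hDI l hl).1
      simp only [indGadget] at h2
      rw [h2]; exact (hDI l hl).2
  | succ k ih =>
    rintro I z (h | ⟨v, hv⟩) u hu
    · exact (ih h u hu).mono_depth (Nat.mul_le_mul_right _ k.le_succ)
    · by_cases hvI : v ∈ I
      -- A repeated query: the branch answering `z v` leaves the subcube unchanged and already
      -- solves it.
      · have h := hv (z v)
        rw [Function.update_eq_self, Finset.insert_eq_of_mem hvI] at h
        exact (ih h u hu).mono_depth (Nat.mul_le_mul_right _ k.le_succ)
      have hinj : Function.Injective fun j : Fin (ptrBits m) => ((v, Sum.inl j) : V × IndVar m) := by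
        intro i j hij; simpa using hij
      have hQ : (k + 1) * (ptrBits m + 1) = k * (ptrBits m + 1) + 1 +
          (Finset.univ.image fun j : Fin (ptrBits m) => ((v, Sum.inl j) : V × IndVar m)).card := by
        rw [Finset.card_image_of_injective _ hinj, Finset.card_univ, Fintype.card_fin]; ring
      rw [hQ]
      refine Solv.query _ fun w hw => ?_
      -- The cell to read depends on the pointer bits `w` just obtained, so this query comes last.
      refine Solv.query_one (v, Sum.inr (dec fun j => w (v, Sum.inl j))) fun w' hw' => ?_
      have hold : ∀ v' ∈ I, ∀ a, (v', a) ∈ readVars dec I u → w' (v', a) = u (v', a) := by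
        intro v' hv' a ha
        have hne : v' ≠ v := by rintro rfl; exact hvI hv'
        rw [hw' _ (by simp [ha]) (by simp [hne]), hw _ ha (by simp [Ne.symm hne])]
      have hptr : ∀ v' ∈ I, (fun j => w' (v', Sum.inl j)) = fun j => u (v', Sum.inl j) :=
        fun v' hv' => funext fun j =>
          hold v' hv' _ ((mem_readVars dec).2 ⟨hv', Or.inl ⟨j, rfl⟩⟩)
      have hptr' : (fun j => w' (v, Sum.inl j)) = fun j => w (v, Sum.inl j) :=
        funext fun j => hw' _ (by simp) (by simp)
      have key := ih (hv (indGadget dec fun a => w' (v, a))) w' ?_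
      · refine key.mono_cube (fun a ha => ?_) (fun _ _ => rfl)
        obtain ⟨ha1, ha2⟩ := (mem_readVars dec).1 ha
        obtain ⟨a1, a2⟩ := a
        simp only [Finset.mem_union, Finset.mem_singleton, Finset.mem_image, Finset.mem_univ,
          true_and]
        by_cases hav : a1 = v
        · subst hav
          rcases ha2 with ⟨j, rfl⟩ | h
          · exact Or.inl (Or.inr ⟨j, rfl⟩)
          · exact Or.inr (Prod.ext rfl (h.trans (congrArg (fun f => Sum.inr (dec f)) hptr')))
        · have ha1' : a1 ∈ I := by simpa [hav] using ha1
          refine Or.inl (Or.inl ((mem_readVars dec).2 ⟨ha1', ?_⟩))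
          simpa [hptr a1 ha1'] using ha2
      · intro v' hv'
        by_cases hne : v' = v
        · subst hne; simp
        · have hv'' : v' ∈ I := by simpa [hne] using hv'
          rw [Function.update_of_ne hne, ← hu v' hv'']
          simp only [indGadget, hptr v' hv'']
          exact hold v' hv'' _ ((mem_readVars dec).2 ⟨hv'', Or.inr rfl⟩)

end Index

theorem queryComplexity_indGadget_le {m : ℕ} (dec : (Fin (ptrBits m) → Bool) → Fin m) :
    queryComplexity (indGadget dec) ≤ ptrBits m + 1 := by
  refine Solv.decDepth_le (z := fun _ => false) ?_
  have hQ : ptrBits m + 1 = 0 + 1 +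
      (Finset.univ.image fun j : Fin (ptrBits m) => (Sum.inl j : IndVar m)).card := by
    rw [Finset.card_image_of_injective _ Sum.inl_injective, Finset.card_univ, Fintype.card_fin]
    ring
  rw [hQ]
  refine Solv.query _ fun w _ => ?_
  refine Solv.query_one (Sum.inr (dec fun j => w (Sum.inl j))) fun w' hw' =>
    ⟨indGadget dec w', fun x hx => ?_⟩
  have h1 : ∀ j, x (Sum.inl j) = w' (Sum.inl j) := fun j => hx _ (by simp)
  have h2 : ∀ j, w' (Sum.inl j) = w (Sum.inl j) := fun j => hw' _ (by simp) (by simp)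
  simp only [indGadget, h1]
  refine hx _ ?_
  simp [h2]

/-! ### A level inequality for subsets of the cube -/

/-- Bernoulli handles `(1 - t) ^ (1 + ε)`. For the other term, `exp s ≥ 1 + s` and `log (1 + t) ≥ 2t
/ (t + 2)` gain `ε (t + t² / 3)`, whose linear part cancels the loss in Bernoulli. -/
theorem two_point_rpow {t ε : ℝ} (ht0 : 0 ≤ t) (ht1 : t ≤ 1) (hε : 0 ≤ ε) :
    1 + ε / 6 * t ^ 2 ≤ ((1 + t) ^ (1 + ε) + (1 - t) ^ (1 + ε)) / 2 := by
  have h1 : 1 + (1 + ε) * (-t) ≤ (1 + (-t)) ^ (1 + ε) :=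
    one_add_mul_self_le_rpow_one_add (by linarith) (by linarith)
  have h2 : (1 + t) * (1 + ε * (2 * t / (t + 2))) ≤ (1 + t) ^ (1 + ε) := by
    rw [Real.rpow_add (by linarith), Real.rpow_one]
    gcongr
    rw [Real.rpow_def_of_pos (by linarith)]
    have h3 := Real.le_log_one_add_of_nonneg ht0
    have h4 := Real.add_one_le_exp (Real.log (1 + t) * ε)
    have h5 := mul_le_mul_of_nonneg_left h3 hε
    linarith
  have h3 : t + t ^ 2 / 3 ≤ (1 + t) * (2 * t / (t + 2)) := by
    rw [mul_div_assoc', le_div_iff₀ (by linarith)]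
    nlinarith [mul_nonneg (sq_nonneg t) (sub_nonneg.2 ht1)]
  have h4 := mul_le_mul_of_nonneg_left h3 hε
  rw [← sub_eq_add_neg] at h1
  nlinarith

/-- The two-point inequality behind hypercontractivity. -/
theorem two_point_norm {a b ε : ℝ} (ha : 0 ≤ a) (hb : 0 ≤ b) (hε : 0 ≤ ε) (hε1 : ε ≤ 1) :
    (1 + ε / 6) * (a ^ 2 + b ^ 2) + 2 * (1 - ε / 6) * (a * b) ≤
      4 * (((a ^ (1 + ε) + b ^ (1 + ε)) / 2) ^ (1 / (1 + ε))) ^ 2 := by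
  wlog hab : b ≤ a generalizing a b
  · have := this hb ha (le_of_not_ge hab)
    rw [add_comm (b ^ (1 + ε))] at this
    nlinarith
  rcases ha.eq_or_lt with rfl | ha0
  · obtain rfl : b = 0 := le_antisymm hab hb
    simp; positivity
  -- By homogeneity only the relative deviation `t` from the mean `u` matters; the quadratic form on
  -- the left becomes `4 u² (1 + ε t² / 6)`.
  set u := (a + b) / 2 with hu
  have hu0 : 0 < u := by positivity
  set t := (a - b) / (a + b) with ht
  have hs : 0 < a + b := by positivity
  have ht0 : 0 ≤ t := div_nonneg (by linarith) hs.le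
  have ht1 : t ≤ 1 := by rw [ht, div_le_one hs]; linarith
  have hA : a = u * (1 + t) := by rw [hu, ht]; field_simp; ring
  have hB : b = u * (1 - t) := by rw [hu, ht]; field_simp; ring
  have key := two_point_rpow ht0 ht1 hε
  have h1 : u ^ (1 + ε) * (1 + ε / 6 * t ^ 2) ≤ (a ^ (1 + ε) + b ^ (1 + ε)) / 2 := by
    rw [hA, hB, Real.mul_rpow hu0.le (by linarith), Real.mul_rpow hu0.le (by linarith)]
    have := mul_le_mul_of_nonneg_left key (Real.rpow_nonneg hu0.le (1 + ε))
    linarith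
  have hp : 0 < 1 + ε := by linarith
  have hbase : 1 ≤ 1 + ε / 6 * t ^ 2 := by
    have : 0 ≤ ε / 6 * t ^ 2 := by positivity
    linarith
  have h2 : u * (1 + ε / 6 * t ^ 2) ^ (1 / (1 + ε)) ≤
      ((a ^ (1 + ε) + b ^ (1 + ε)) / 2) ^ (1 / (1 + ε)) := by
    refine le_trans (le_of_eq ?_) (Real.rpow_le_rpow (by positivity) h1 (by positivity))
    rw [Real.mul_rpow (by positivity) (by positivity), ← Real.rpow_mul hu0.le,
      mul_one_div_cancel hp.ne', Real.rpow_one]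
  -- The total exponent `2 / (1 + ε)` is at least 1 because `ε ≤ 1`.
  have h3 : 1 + ε / 6 * t ^ 2 ≤ ((1 + ε / 6 * t ^ 2) ^ (1 / (1 + ε))) ^ 2 := by
    rw [← Real.rpow_natCast (_ ^ _) 2, ← Real.rpow_mul (by linarith)]
    refine Real.self_le_rpow_of_one_le hbase ?_
    rw [one_div, Nat.cast_ofNat, ← div_eq_inv_mul, le_div_iff₀ hp]
    linarith
  have h4 : (u * (1 + ε / 6 * t ^ 2) ^ (1 / (1 + ε))) ^ 2 ≤
      (((a ^ (1 + ε) + b ^ (1 + ε)) / 2) ^ (1 / (1 + ε))) ^ 2 :=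
    pow_le_pow_left₀ (by positivity) h2 2
  have h5 : u ^ 2 * (1 + ε / 6 * t ^ 2) ≤
      (u * (1 + ε / 6 * t ^ 2) ^ (1 / (1 + ε))) ^ 2 := by
    rw [mul_pow]; gcongr
  have h6 : (1 + ε / 6) * (a ^ 2 + b ^ 2) + 2 * (1 - ε / 6) * (a * b) =
      4 * (u ^ 2 * (1 + ε / 6 * t ^ 2)) := by rw [hA, hB]; ring
  linarith

/-- The noise form is positive semidefinite, so Cauchy–Schwarz reduces the bilinear bound to the
quadratic one. The gap in Cauchy–Schwarz is `4 (ε / 6) (ad - bc)²`. -/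
theorem two_point_bilin {a b c d ε : ℝ} (ha : 0 ≤ a) (hb : 0 ≤ b) (hc : 0 ≤ c) (hd : 0 ≤ d)
    (hε : 0 ≤ ε) (hε1 : ε ≤ 1) :
    (1 + ε / 6) * (a * c + b * d) + (1 - ε / 6) * (a * d + b * c) ≤
      4 * (((a ^ (1 + ε) + b ^ (1 + ε)) / 2) ^ (1 / (1 + ε)) *
        ((c ^ (1 + ε) + d ^ (1 + ε)) / 2) ^ (1 / (1 + ε))) := by
  have h1 := two_point_norm ha hb hε hε1
  have h2 := two_point_norm hc hd hε hε1
  set P := ((a ^ (1 + ε) + b ^ (1 + ε)) / 2) ^ (1 / (1 + ε)) with hP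
  set Q := ((c ^ (1 + ε) + d ^ (1 + ε)) / 2) ^ (1 / (1 + ε)) with hQ
  have hP0 : 0 ≤ P := by positivity
  have hQ0 : 0 ≤ Q := by positivity
  have hρ : 0 ≤ ε / 6 := by positivity
  refine abs_le_of_sq_le_sq' ?_ (by positivity) |>.2
  have h3 : ((1 + ε / 6) * (a * c + b * d) + (1 - ε / 6) * (a * d + b * c)) ^ 2 ≤
      ((1 + ε / 6) * (a ^ 2 + b ^ 2) + 2 * (1 - ε / 6) * (a * b)) *
        ((1 + ε / 6) * (c ^ 2 + d ^ 2) + 2 * (1 - ε / 6) * (c * d)) := by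
    nlinarith [mul_nonneg hρ (sq_nonneg (a * d - b * c))]
  refine h3.trans ?_
  have h4 : 0 ≤ (1 + ε / 6) * (c ^ 2 + d ^ 2) + 2 * (1 - ε / 6) * (c * d) := by
    have : 0 ≤ 1 - ε / 6 := by linarith
    positivity
  calc _ ≤ (4 * P ^ 2) * (4 * Q ^ 2) := mul_le_mul h1 h2 h4 (by positivity)
    _ = _ := by ring

/-- The sign of a bit. -/
def sgn (b : Bool) : ℝ := if b then 1 else -1

theorem sgn_mul_self (b : Bool) : sgn b * sgn b = 1 := by cases b <;> simp [sgn]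

theorem abs_sgn (b : Bool) : |sgn b| = 1 := by cases b <;> simp [sgn]

/-- Hypercontractivity of the noise operator on nonnegative functions, in bilinear form. -/
theorem noise_le {ε : ℝ} (hε : 0 ≤ ε) (hε1 : ε ≤ 1) (ι : Type) [Fintype ι] [DecidableEq ι]
    (f g : (ι → Bool) → ℝ) (hf : ∀ x, 0 ≤ f x) (hg : ∀ x, 0 ≤ g x) :
      ∑ x, ∑ y, f x * g y * ∏ i, (1 + ε / 6 * (sgn (x i) * sgn (y i))) ≤
        4 ^ Fintype.card ι * (((∑ x, f x ^ (1 + ε)) / 2 ^ Fintype.card ι) ^ (1 / (1 + ε)) *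
          ((∑ x, g x ^ (1 + ε)) / 2 ^ Fintype.card ι) ^ (1 / (1 + ε))) := by
  have hp : 0 < 1 + ε := by linarith
  revert f g
  rename_i i2
  revert i2
  refine Fintype.induction_empty_option (P := fun ι _ => ∀ [DecidableEq ι],
    ∀ f g : (ι → Bool) → ℝ, (∀ x, 0 ≤ f x) → (∀ x, 0 ≤ g x) →
      ∑ x, ∑ y, f x * g y * ∏ i, (1 + ε / 6 * (sgn (x i) * sgn (y i))) ≤
        4 ^ Fintype.card ι * (((∑ x, f x ^ (1 + ε)) / 2 ^ Fintype.card ι) ^ (1 / (1 + ε)) *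
          ((∑ x, g x ^ (1 + ε)) / 2 ^ Fintype.card ι) ^ (1 / (1 + ε)))) ?_ ?_ ?_ ι
  · intro α β _ e ih _ f g hf hg
    let _ : Fintype α := Fintype.ofEquiv β e.symm
    classical
    have h := ih (fun x => f (x ∘ e.symm)) (fun x => g (x ∘ e.symm)) (fun _ => hf _)
      (fun _ => hg _)
    let E : (α → Bool) ≃ (β → Bool) := e.arrowCongr (Equiv.refl _)
    have hE : ∀ x, E x = x ∘ e.symm := fun x => rfl
    simp only [← hE] at h
    rw [E.sum_comp (fun x => f x ^ (1 + ε)), E.sum_comp (fun x => g x ^ (1 + ε)),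
      Fintype.card_congr e] at h
    refine le_trans (le_of_eq ?_) h
    rw [← E.sum_comp]
    refine Finset.sum_congr rfl fun x _ => ?_
    rw [← E.sum_comp]
    refine Finset.sum_congr rfl fun y _ => ?_
    rw [← e.prod_comp]
    simp [hE]
  · intro _ f g hf hg
    simp only [Fintype.univ_ofIsEmpty, Finset.prod_empty, Fintype.card_eq_zero, pow_zero,
      div_one, one_mul, mul_one, Finset.univ_unique, Finset.sum_singleton]
    rw [← Real.rpow_mul (hf _), ← Real.rpow_mul (hg _), mul_one_div_cancel hp.ne', Real.rpow_one,
      Real.rpow_one]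
  · intro α _ ih _ f g hf hg
    classical
    have hsum : ∀ F : (Option α → Bool) → ℝ,
        ∑ x, F x = ∑ x : α → Bool, F (fun o => o.elim true x) +
          ∑ x : α → Bool, F (fun o => o.elim false x) := by
      intro F
      rw [← (Equiv.piOptionEquivProd (β := fun _ : Option α => Bool)).symm.sum_comp,
        Fintype.sum_prod_type, Fintype.sum_bool]
      congr 1 <;> refine Finset.sum_congr rfl fun x _ => congrArg F (funext fun o => ?_) <;>
        cases o <;> rfl
    set f1 : (α → Bool) → ℝ := fun x => f (fun o => o.elim true x) with hf1
    set f0 : (α → Bool) → ℝ := fun x => f (fun o => o.elim false x) with hf0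
    set g1 : (α → Bool) → ℝ := fun x => g (fun o => o.elim true x) with hg1
    set g0 : (α → Bool) → ℝ := fun x => g (fun o => o.elim false x) with hg0
    have h11 := ih f1 g1 (fun _ => hf _) (fun _ => hg _)
    have h10 := ih f1 g0 (fun _ => hf _) (fun _ => hg _)
    have h01 := ih f0 g1 (fun _ => hf _) (fun _ => hg _)
    have h00 := ih f0 g0 (fun _ => hf _) (fun _ => hg _)
    set N := Fintype.card α with hN
    have hnn : ∀ h : (α → Bool) → ℝ, (∀ x, 0 ≤ h x) → 0 ≤ (∑ x, h x ^ (1 + ε)) / 2 ^ N :=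
      fun h hh => div_nonneg (Finset.sum_nonneg fun x _ => Real.rpow_nonneg (hh x) _)
        (by positivity)
    have n1 := hnn f1 fun _ => hf _
    have n2 := hnn f0 fun _ => hf _
    have n3 := hnn g1 fun _ => hg _
    have n4 := hnn g0 fun _ => hg _
    have hF : (∑ x, f x ^ (1 + ε)) / 2 ^ (N + 1) =
        ((∑ x, f1 x ^ (1 + ε)) / 2 ^ N + (∑ x, f0 x ^ (1 + ε)) / 2 ^ N) / 2 := by
      rw [hsum, pow_succ]; simp only [hf1, hf0]; field_simp
    have hG : (∑ x, g x ^ (1 + ε)) / 2 ^ (N + 1) =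
        ((∑ x, g1 x ^ (1 + ε)) / 2 ^ N + (∑ x, g0 x ^ (1 + ε)) / 2 ^ N) / 2 := by
      rw [hsum, pow_succ]; simp only [hg1, hg0]; field_simp
    have hback : ∀ s : ℝ, 0 ≤ s → (s ^ (1 / (1 + ε))) ^ (1 + ε) = s := by
      intro s hs
      rw [← Real.rpow_mul hs, one_div_mul_cancel hp.ne', Real.rpow_one]
    -- Tensorisation: after the induction hypothesis on the four pairs of restrictions, the
    -- two-point inequality is applied to the norms of these restrictions.
    have key := two_point_bilin (Real.rpow_nonneg n1 (1 / (1 + ε)))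
      (Real.rpow_nonneg n2 (1 / (1 + ε))) (Real.rpow_nonneg n3 (1 / (1 + ε)))
      (Real.rpow_nonneg n4 (1 / (1 + ε))) hε hε1
    rw [hback _ n1, hback _ n2, hback _ n3, hback _ n4] at key
    rw [Fintype.card_option, ← hN, hF, hG]
    have hL : ∑ x, ∑ y, f x * g y * ∏ i, (1 + ε / 6 * (sgn (x i) * sgn (y i))) =
        (1 + ε / 6) * (∑ x, ∑ y, f1 x * g1 y * ∏ i, (1 + ε / 6 * (sgn (x i) * sgn (y i))) +
          ∑ x, ∑ y, f0 x * g0 y * ∏ i, (1 + ε / 6 * (sgn (x i) * sgn (y i)))) +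
        (1 - ε / 6) * (∑ x, ∑ y, f1 x * g0 y * ∏ i, (1 + ε / 6 * (sgn (x i) * sgn (y i))) +
          ∑ x, ∑ y, f0 x * g1 y * ∏ i, (1 + ε / 6 * (sgn (x i) * sgn (y i)))) := by
      simp only [hsum, Fintype.prod_option, Option.elim_none, Option.elim_some,
        Finset.sum_add_distrib]
      simp only [hf1, hf0, hg1, hg0, Finset.mul_sum, mul_add]
      have r : ∀ a b c d a' b' c' d' : ℝ, a = a' → b = b' → c = c' → d = d' →
          a + b + (c + d) = a' + d' + (b' + c') := by intros; subst_vars; ring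
      refine r _ _ _ _ _ _ _ _ ?_ ?_ ?_ ?_ <;>
        refine Finset.sum_congr rfl fun x _ => Finset.sum_congr rfl fun y _ => ?_ <;>
        simp [sgn] <;> ring
    rw [hL]
    have h1 : 0 ≤ 1 - ε / 6 := by linarith
    have e1 := mul_le_mul_of_nonneg_left (add_le_add h11 h00) (by linarith : 0 ≤ 1 + ε / 6)
    have e2 := mul_le_mul_of_nonneg_left (add_le_add h10 h01) h1
    have e3 := mul_le_mul_of_nonneg_left key (by positivity : (0 : ℝ) ≤ 4 ^ N)
    refine (add_le_add e1 e2).trans ((le_of_eq ?_).trans (e3.trans (le_of_eq ?_))) <;> ring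

/-- The character of the set `s`. -/
def chi {ι : Type} (s : Finset ι) (y : ι → Bool) : ℝ := ∏ i ∈ s, sgn (y i)

/-- A weighted bound on the Fourier weight of a dense subset of the cube. -/
theorem level_le {ι : Type} [Fintype ι] [DecidableEq ι] (Y : Finset (ι → Bool)) {ρ Δ : ℝ}
    (hρ : 0 ≤ ρ) (hρ1 : ρ ≤ 1 / 6) (hΔ : 0 ≤ Δ) (hY : (2 : ℝ) ^ Fintype.card ι ≤ Y.card * 2 ^ Δ) :
    ∑ s : Finset ι, ρ ^ s.card * ((∑ y ∈ Y, chi s y) / Y.card) ^ 2 ≤ (2 : ℝ) ^ (12 * ρ * Δ) := by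
  -- Then the kernel of `noise_le` has correlation `ρ`, and `ρ ≤ 1 / 6` gives `ε ≤ 1`.
  set ε := 6 * ρ with hε
  have hε6 : ε / 6 = ρ := by rw [hε]; ring
  have hε0 : 0 ≤ ε := by positivity
  have hp : 0 < 1 + ε := by linarith
  set N := Fintype.card ι with hN
  set E : ℝ := (Y.card : ℝ) with hE
  have hE0 : 0 < E := by
    by_contra h
    have : E = 0 := le_antisymm (not_lt.1 h) (by positivity)
    rw [this, zero_mul] at hY
    exact absurd hY (not_le.2 (by positivity))
  have hi0 : ∀ x, (0 : ℝ) ≤ if x ∈ Y then 1 else 0 := fun x => by split_ifs <;> norm_num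
  have key := noise_le hε0 (by linarith) ι (fun x => if x ∈ Y then 1 else 0)
    (fun x => if x ∈ Y then 1 else 0) hi0 hi0
  have hsum : ∑ x : ι → Bool, (if x ∈ Y then (1 : ℝ) else 0) ^ (1 + ε) = E := by
    have h1 : ∀ x : ι → Bool, (if x ∈ Y then (1 : ℝ) else 0) ^ (1 + ε) =
        if x ∈ Y then 1 else 0 := by
      intro x; split_ifs
      · exact Real.one_rpow _
      · exact Real.zero_rpow hp.ne'
    simp [h1, hE]
  rw [hsum, hε6, ← hN] at key
  -- Expanding the product over coordinates diagonalises the noise kernel in the characters.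
  have hL : ∑ s : Finset ι, ρ ^ s.card * (∑ y ∈ Y, chi s y) ^ 2 =
      ∑ x : ι → Bool, ∑ y : ι → Bool, (if x ∈ Y then (1 : ℝ) else 0) *
        (if y ∈ Y then 1 else 0) * ∏ i, (1 + ρ * (sgn (x i) * sgn (y i))) := by
    have h1 : ∀ x y : ι → Bool, ∏ i, (1 + ρ * (sgn (x i) * sgn (y i))) =
        ∑ s : Finset ι, ρ ^ s.card * (chi s x * chi s y) := by
      intro x y
      rw [Finset.prod_one_add, Finset.powerset_univ]
      refine Finset.sum_congr rfl fun s _ => ?_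
      rw [Finset.prod_mul_distrib, Finset.prod_mul_distrib, Finset.prod_const]; rfl
    have h2 : ∀ s : Finset ι, ρ ^ s.card * (∑ y ∈ Y, chi s y) ^ 2 =
        ∑ x ∈ Y, ∑ y ∈ Y, ρ ^ s.card * (chi s x * chi s y) := by
      intro s
      rw [sq, Finset.sum_mul_sum, Finset.mul_sum]
      exact Finset.sum_congr rfl fun x _ => Finset.mul_sum _ _ _
    simp only [h1, h2, ite_mul, one_mul, zero_mul, Finset.sum_ite_mem, Finset.univ_inter,
      Finset.sum_const_zero, Finset.sum_ite_irrel]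
    rw [Finset.sum_comm]
    exact Finset.sum_congr rfl fun x _ => Finset.sum_comm
  rw [← hL] at key
  have hq : E / 2 ^ N ≤ 1 := by
    rw [div_le_one (by positivity)]
    have : Y.card ≤ 2 ^ N := by
      simpa [hN] using Finset.card_le_univ Y
    rw [hE]; exact_mod_cast this
  have hq0 : 0 < E / 2 ^ N := by positivity
  have h4 : (4 : ℝ) ^ N = (2 ^ N) ^ 2 := by rw [← pow_mul, mul_comm, pow_mul]; norm_num
  have hfin : ∑ s : Finset ι, ρ ^ s.card * ((∑ y ∈ Y, chi s y) / E) ^ 2 =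
      (∑ s : Finset ι, ρ ^ s.card * (∑ y ∈ Y, chi s y) ^ 2) / E ^ 2 := by
    rw [Finset.sum_div]
    exact Finset.sum_congr rfl fun s _ => by rw [div_pow, mul_div_assoc]
  rw [hfin]
  have hmass : (2 : ℝ) ^ (-Δ) ≤ E / 2 ^ N := by
    rw [Real.rpow_neg (by norm_num), le_div_iff₀ (by positivity), inv_mul_le_iff₀ (by positivity)]
    rw [mul_comm]; exact hY
  set q := E / 2 ^ N with hqdef
  have hEq : E = q * 2 ^ N := (div_mul_cancel₀ _ (pow_pos two_pos N).ne').symm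
  have hstep : (∑ s : Finset ι, ρ ^ s.card * (∑ y ∈ Y, chi s y) ^ 2) / E ^ 2 ≤
      q ^ (1 / (1 + ε)) * q ^ (1 / (1 + ε)) * (q ^ 2)⁻¹ := by
    rw [div_le_iff₀ (pow_pos hE0 2)]
    refine key.trans (le_of_eq ?_)
    have hq3 : (q ^ 2)⁻¹ * q ^ 2 = 1 := inv_mul_cancel₀ (pow_pos hq0 2).ne'
    have hE2 : E ^ 2 = q ^ 2 * (2 ^ N) ^ 2 := by rw [hEq]; ring
    rw [h4, hE2]
    generalize q ^ (1 / (1 + ε)) = a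
    linear_combination (-(a * a) * (2 ^ N) ^ 2) * hq3
  refine hstep.trans ?_
  have hq2 : (q ^ 2)⁻¹ = q ^ (-2 : ℝ) := by
    rw [Real.rpow_neg hq0.le]; norm_num
  rw [hq2, ← Real.rpow_add hq0, ← Real.rpow_add hq0]
  -- Two norms of the indicator divided by the squared density leave a negative power of `q`, at
  -- most `2 ^ (2εΔ) = 2 ^ (12ρΔ)`.
  have hexp : 1 / (1 + ε) + 1 / (1 + ε) + -2 = -(2 * ε / (1 + ε)) := by field_simp; ring
  rw [hexp]
  calc q ^ (-(2 * ε / (1 + ε))) ≤ ((2 : ℝ) ^ (-Δ)) ^ (-(2 * ε / (1 + ε))) :=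
        Real.rpow_le_rpow_of_nonpos (by positivity) hmass
          (by rw [neg_nonpos]; positivity)
    _ = (2 : ℝ) ^ (Δ * (2 * ε / (1 + ε))) := by
        rw [← Real.rpow_mul (by norm_num)]; ring_nf
    _ ≤ (2 : ℝ) ^ (12 * ρ * Δ) := by
        refine Real.rpow_le_rpow_of_exponent_le (by norm_num) ?_
        have : 2 * ε / (1 + ε) ≤ 2 * ε := div_le_self (by positivity) (by linarith)
        nlinarith

/-- AM–GM with a free weight. With `l` geometric in the level, it trades a sum of absolute Fourier
coefficients for the level-weighted squares that `level_le` controls. -/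
theorem abs_le_half_add_sq_div (a : ℝ) {l : ℝ} (hl : 0 < l) : |a| ≤ (l + a ^ 2 / l) / 2 := by
  have h := two_mul_le_add_sq l |a|
  rw [le_div_iff₀ two_pos, ← sub_nonneg]
  have : l + a ^ 2 / l - |a| * 2 = (l ^ 2 + |a| ^ 2 - 2 * l * |a|) / l := by
    rw [sq_abs]; field_simp
  rw [this]
  exact div_nonneg (by linarith) hl.le

/-! ### Spread sets of pointers against dense sets of vectors -/

section Spread

theorem graph_mk_injective {V M : Type} (x : V → M) : Function.Injective fun v => (v, x v) :=
  fun _ _ h => congrArg Prod.fst h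

variable {V M : Type} [DecidableEq V] [DecidableEq M] [Fintype V] [Fintype M]

/-- The restriction of the graph of `x` to `T`. -/
def graphOn (x : V → M) (T : Finset V) : Finset (V × M) := T.image fun v => (v, x v)

theorem mem_graphOn {x : V → M} {T : Finset V} {a : V × M} :
    a ∈ graphOn x T ↔ a.1 ∈ T ∧ a.2 = x a.1 := by
  obtain ⟨v, p⟩ := a
  simp only [graphOn, Finset.mem_image, Prod.mk.injEq]
  constructor
  · rintro ⟨u, hu, rfl, rfl⟩; exact ⟨hu, rfl⟩
  · rintro ⟨h1, h2⟩; exact ⟨v, h1, rfl, h2.symm⟩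

theorem card_graphOn (x : V → M) (T : Finset V) : (graphOn x T).card = T.card :=
  Finset.card_image_of_injective _ (graph_mk_injective x)

theorem graphOn_injective (x : V → M) : Function.Injective (graphOn x) :=
  Finset.image_injective (graph_mk_injective x)

theorem chi_graphOn (x : V → M) (T : Finset V) (y : V × M → Bool) :
    chi (graphOn x T) y = ∏ v ∈ T, sgn (y (v, x v)) :=
  Finset.prod_image fun _ _ _ _ h => graph_mk_injective x h

/-- The number of strings in `Y` that agree with `b` on the part over `I` of the graph of `x`, in
terms of Fourier coefficients. -/
theorem card_agree_ge (x : V → M) (I : Finset V) (b : V → Bool) (Y : Finset (V × M → Bool)) :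
    (Y.card : ℝ) - ∑ T ∈ I.powerset.erase ∅, |∑ y ∈ Y, chi (graphOn x T) y| ≤
      2 ^ I.card * (Y.filter fun y => ∀ v ∈ I, y (v, x v) = b v).card := by
  -- The product is `2 ^ I.card` times the indicator of agreement; expanding it gives the characters
  -- over subsets of `I`.
  have h1 : ∀ y : V × M → Bool, (∏ v ∈ I, (1 + sgn (b v) * sgn (y (v, x v)))) =
      if ∀ v ∈ I, y (v, x v) = b v then 2 ^ I.card else 0 := by
    intro y
    split_ifs with h
    · rw [← Finset.prod_const]
      exact Finset.prod_congr rfl fun v hv => by rw [h v hv, sgn_mul_self]; norm_num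
    · push Not at h
      obtain ⟨v, hv, hne⟩ := h
      refine Finset.prod_eq_zero hv ?_
      revert hne
      cases b v <;> cases y (v, x v) <;> simp [sgn]
  have h2 : (2 : ℝ) ^ I.card * (Y.filter fun y => ∀ v ∈ I, y (v, x v) = b v).card =
      ∑ T ∈ I.powerset, (∏ v ∈ T, sgn (b v)) * ∑ y ∈ Y, chi (graphOn x T) y := by
    rw [mul_comm, ← nsmul_eq_mul, ← Finset.sum_const, Finset.sum_filter]
    simp only [← h1, Finset.mul_sum, chi_graphOn, ← Finset.prod_mul_distrib]
    rw [Finset.sum_comm]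
    exact Finset.sum_congr rfl fun y _ => Finset.prod_one_add _
  rw [h2, ← Finset.add_sum_erase _ _ (Finset.empty_mem_powerset I)]
  have h3 : (∏ v ∈ (∅ : Finset V), sgn (b v)) * ∑ y ∈ Y, chi (graphOn x ∅) y = Y.card := by
    simp [graphOn, chi]
  rw [h3, sub_eq_add_neg, ← Finset.sum_neg_distrib]
  gcongr with T _
  have h4 : |(∏ v ∈ T, sgn (b v)) * ∑ y ∈ Y, chi (graphOn x T) y| =
      |∑ y ∈ Y, chi (graphOn x T) y| := by
    rw [abs_mul, Finset.abs_prod]; simp [abs_sgn]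
  rw [← h4]
  exact neg_abs_le _

/-- Summing a function of the sub-graphs of the members of a spread family. -/
theorem sum_graphOn_le (X : Finset (V → M)) (I₀ : Finset V) {κ : ℝ} (hκ : 0 < κ)
    (hspread : ∀ T, Disjoint T I₀ → ∀ x₀ : V → M,
      ((X.filter fun x => ∀ v ∈ T, x v = x₀ v).card : ℝ) * κ ^ T.card ≤ 4 * X.card)
    (I : (V → M) → Finset V) (hI : ∀ x ∈ X, Disjoint (I x) I₀)
    (w : Finset (V × M) → ℝ) (hw : ∀ s, 0 ≤ w s) :
    ∑ x ∈ X, ∑ T ∈ (I x).powerset.erase ∅, κ ^ T.card * w (graphOn x T) ≤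
      4 * X.card * ∑ s ∈ Finset.univ.erase ∅, w s := by
  -- A set `s` is the graph of `x` over at most one `T`, so the sum can be indexed by `s`. After
  -- interchanging the sums, spreadness bounds the number of `x` whose graph contains `s`.
  have h1 : ∀ x ∈ X, ∑ T ∈ (I x).powerset.erase ∅, κ ^ T.card * w (graphOn x T) =
      ∑ s ∈ Finset.univ.erase ∅, if s ∈ ((I x).powerset.erase ∅).image (graphOn x) then
        κ ^ s.card * w s else 0 := by
    intro x _
    have h2 : (Finset.univ.erase ∅).filter
        (fun s => s ∈ ((I x).powerset.erase ∅).image (graphOn x)) =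
          ((I x).powerset.erase ∅).image (graphOn x) := by
      ext s
      simp only [Finset.mem_filter, Finset.mem_erase, Finset.mem_univ, and_true,
        and_iff_right_iff_imp, Finset.mem_image]
      rintro ⟨T, ⟨hT, -⟩, rfl⟩
      rwa [ne_eq, ← Finset.card_eq_zero, card_graphOn, Finset.card_eq_zero]
    rw [← Finset.sum_filter, h2, Finset.sum_image fun _ _ _ _ h => graphOn_injective x h]
    exact Finset.sum_congr rfl fun T _ => by rw [card_graphOn]
  rw [Finset.sum_congr rfl h1, Finset.sum_comm, Finset.mul_sum]
  refine Finset.sum_le_sum fun s _ => ?_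
  rw [← Finset.sum_filter, Finset.sum_const, nsmul_eq_mul, ← mul_assoc]
  refine mul_le_mul_of_nonneg_right ?_ (hw s)
  rcases (X.filter fun x => s ∈ ((I x).powerset.erase ∅).image (graphOn x)).eq_empty_or_nonempty
    with h | ⟨x₀, hx₀⟩
  · rw [h]; simp
  · simp only [Finset.mem_filter, Finset.mem_image, Finset.mem_erase, Finset.mem_powerset] at hx₀
    obtain ⟨hx₀, T₀, ⟨-, hT₀⟩, rfl⟩ := hx₀
    refine le_trans ?_ (hspread T₀ (Finset.disjoint_of_subset_left hT₀ (hI x₀ hx₀)) x₀)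
    rw [card_graphOn]
    gcongr with x hx
    simp only [Finset.mem_image, Finset.mem_erase, Finset.mem_powerset]
    rintro ⟨T, -, hT⟩ v hv
    have : (v, x₀ v) ∈ graphOn x T := by rw [hT]; exact mem_graphOn.2 ⟨hv, rfl⟩
    exact (mem_graphOn.1 this).2.symm

theorem two_rpow_le : (2 : ℝ) ^ (3 / 25 : ℝ) ≤ 9 / 8 := by
  have h : (2 : ℝ) ^ (3 / 25 : ℝ) = ((2 : ℝ) ^ (3 : ℝ)) ^ (25 : ℝ)⁻¹ := by
    rw [← Real.rpow_mul (by norm_num)]; norm_num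
  rw [h, Real.rpow_inv_le_iff_of_pos (by positivity) (by norm_num) (by norm_num)]
  norm_num

/-- If `X` is spread and `Y` is dense, then some `x ∈ X` is compatible with a large part of `Y`,
whatever bits `b x` are prescribed for the cells that `x` points to in the blocks `I x`. -/
theorem exists_compatible (X : Finset (V → M)) (hX : X.Nonempty) (I₀ : Finset V) {κ Δ : ℝ}
    {K : ℕ} (hΔ : 1 ≤ Δ) (hκ0 : 0 < κ) (hκ : 400 * Δ * K ≤ κ)
    (hspread : ∀ T, Disjoint T I₀ → ∀ x₀ : V → M,
      ((X.filter fun x => ∀ v ∈ T, x v = x₀ v).card : ℝ) * κ ^ T.card ≤ 4 * X.card)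
    (I : (V → M) → Finset V) (hI : ∀ x ∈ X, Disjoint (I x) I₀) (hIK : ∀ x ∈ X, (I x).card ≤ K)
    (b : (V → M) → V → Bool) (Y : Finset (V × M → Bool))
    (hY : (2 : ℝ) ^ Fintype.card (V × M) ≤ Y.card * 2 ^ Δ) :
    ∃ x ∈ X, (Y.card : ℝ) ≤
      2 ^ ((I x).card + 1) * (Y.filter fun y => ∀ v ∈ I x, y (v, x v) = b x v).card := by
  by_contra! hcon
  have hE : (0 : ℝ) < Y.card := by
    by_contra h
    have : (Y.card : ℝ) = 0 := le_antisymm (not_lt.1 h) (by positivity)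
    rw [this, zero_mul] at hY
    exact absurd hY (not_le.2 (by positivity))
  set E : ℝ := (Y.card : ℝ) with hEdef
  set a : Finset (V × M) → ℝ := fun s => (∑ y ∈ Y, chi s y) / E with ha
  -- This makes `12ρΔ = 3 / 25`, so the nonempty levels carry weight at most `9 / 8 - 1`. The weight
  -- `l` below turns `a² / l ^ |T|` into `κ ^ |T| ρ ^ |T| a²`, and `l K ≤ 1 / 4` by the bound on
  -- `κ`.
  set ρ : ℝ := 1 / (100 * Δ) with hρ
  have hΔ0 : 0 < Δ := by linarith
  have hρ0 : 0 < ρ := by positivity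
  set l : ℝ := 1 / (ρ * κ) with hl
  have hl0 : 0 < l := by positivity
  have hbig : ∀ x ∈ X, 1 / 2 < ∑ T ∈ (I x).powerset.erase ∅, |a (graphOn x T)| := by
    intro x hx
    have h1 : E - ∑ T ∈ (I x).powerset.erase ∅, |∑ y ∈ Y, chi (graphOn x T) y| ≤
        2 ^ (I x).card * (Y.filter fun y => ∀ v ∈ I x, y (v, x v) = b x v).card := by
      exact card_agree_ge x (I x) (b x) Y
    have h2 := hcon x hx
    rw [pow_succ] at h2
    have h3 : ∑ T ∈ (I x).powerset.erase ∅, |a (graphOn x T)| =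
        (∑ T ∈ (I x).powerset.erase ∅, |∑ y ∈ Y, chi (graphOn x T) y|) / E := by
      rw [Finset.sum_div]
      exact Finset.sum_congr rfl fun T _ => by rw [ha, abs_div, abs_of_pos hE]
    rw [h3, lt_div_iff₀ hE]
    linarith
  have hlam : ∀ x ∈ X, ∑ T ∈ (I x).powerset.erase ∅, l ^ T.card ≤ 1 / 3 := by
    intro x hx
    have h1 : ∑ T ∈ (I x).powerset, l ^ T.card = (l + 1) ^ (I x).card := by
      rw [← Finset.sum_pow_mul_eq_add_pow]; simp
    rw [← Finset.add_sum_erase _ _ (Finset.empty_mem_powerset (I x))] at h1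
    have h2 : (l + 1) ^ (I x).card ≤ Real.exp (1 / 4) := by
      calc (l + 1) ^ (I x).card ≤ (l + 1) ^ K := pow_le_pow_right₀ (by linarith) (hIK x hx)
        _ ≤ Real.exp l ^ K := by gcongr; exact Real.add_one_le_exp l
        _ = Real.exp (K * l) := (Real.exp_nat_mul l K).symm
        _ ≤ Real.exp (1 / 4) := by
            gcongr
            have : l = 100 * Δ / κ := by rw [hl, hρ]; field_simp
            rw [this, mul_div_assoc', div_le_iff₀ hκ0]
            linarith
    have h3 : Real.exp (1 / 4) ≤ 4 / 3 := by
      have h4 := Real.add_one_le_exp (-(1 / 4) : ℝ)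
      rw [Real.exp_neg] at h4
      have h5 := Real.exp_pos (1 / 4)
      rw [le_inv_comm₀ (by norm_num) h5] at h4
      norm_num at h4 ⊢; exact h4
    simp only [Finset.card_empty, pow_zero] at h1
    linarith
  have hlevel : ∑ s ∈ Finset.univ.erase (∅ : Finset (V × M)), ρ ^ s.card * a s ^ 2 ≤ 1 / 8 := by
    have h1 := level_le Y hρ0.le (by
      rw [hρ]; exact one_div_le_one_div_of_le (by norm_num) (by linarith)) hΔ0.le hY
    rw [← Finset.add_sum_erase _ _ (Finset.mem_univ ∅)] at h1
    have h2 : 12 * ρ * Δ = 3 / 25 := by rw [hρ]; field_simp; norm_num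
    have h3 : ρ ^ (∅ : Finset (V × M)).card * ((∑ y ∈ Y, chi ∅ y) / (Y.card : ℝ)) ^ 2 = 1 := by
      have h4 : ∑ y ∈ Y, chi ∅ y = (Y.card : ℝ) := by simp [chi]
      rw [h4, div_self hE.ne']; simp
    rw [h2, h3] at h1
    have h4 := two_rpow_le
    have h5 : ∑ s ∈ Finset.univ.erase (∅ : Finset (V × M)), ρ ^ s.card * a s ^ 2 =
      ∑ s ∈ Finset.univ.erase (∅ : Finset (V × M)),
        ρ ^ s.card * ((∑ y ∈ Y, chi s y) / (Y.card : ℝ)) ^ 2 := rfl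
    linarith
  have hsq := sum_graphOn_le X I₀ hκ0 hspread I hI (fun s => ρ ^ s.card * a s ^ 2)
    (fun s => by positivity)
  have h1 : (X.card : ℝ) * (1 / 2) <
      ∑ x ∈ X, ∑ T ∈ (I x).powerset.erase ∅, |a (graphOn x T)| := by
    rw [← nsmul_eq_mul, ← Finset.sum_const]
    exact Finset.sum_lt_sum_of_nonempty hX hbig
  have h2 : ∑ x ∈ X, ∑ T ∈ (I x).powerset.erase ∅, |a (graphOn x T)| ≤
      (∑ x ∈ X, ∑ T ∈ (I x).powerset.erase ∅, l ^ T.card) / 2 +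
      (∑ x ∈ X, ∑ T ∈ (I x).powerset.erase ∅,
        κ ^ T.card * (ρ ^ (graphOn x T).card * a (graphOn x T) ^ 2)) / 2 := by
    rw [← add_div, ← Finset.sum_add_distrib, Finset.sum_div]
    refine Finset.sum_le_sum fun x _ => ?_
    rw [← Finset.sum_add_distrib, Finset.sum_div]
    refine Finset.sum_le_sum fun T _ => ?_
    refine (abs_le_half_add_sq_div _ (pow_pos hl0 T.card)).trans (le_of_eq ?_)
    rw [card_graphOn, hl, one_div, inv_pow, div_inv_eq_mul, mul_pow]
    ring
  have h3 : ∑ x ∈ X, ∑ T ∈ (I x).powerset.erase ∅, l ^ T.card ≤ X.card * (1 / 3) := by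
    rw [← nsmul_eq_mul]
    exact Finset.sum_le_card_nsmul _ _ _ hlam
  have hX0 : (0 : ℝ) < X.card := by exact_mod_cast hX.card_pos
  -- Per element of `X`, the average is above `1 / 2` by `h1`, but at most `1 / 6 + 1 / 4` by `h2`.
  nlinarith [mul_le_mul_of_nonneg_left hlevel hX0.le]

end Spread

/-! ### Balancing -/

namespace FeasTree

variable {I O : Type}

/-- The tree is an `𝓕`-tree that is correct on the inputs in `R`. -/
def ValidOn (𝓕 : Set (Set I)) (S : SearchProblem I O) (R : Set I) : FeasTree I → Prop
  | leaf f => f ∈ 𝓕 ∧ ∃ o, ∀ x ∈ R, x ∈ f → S x o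
  | node₁ f t => f ∈ 𝓕 ∧ (∀ x ∈ R, x ∈ f → x ∈ t.root) ∧ t.ValidOn 𝓕 S R
  | node₂ f t₁ t₂ => f ∈ 𝓕 ∧ (∀ x ∈ R, x ∈ f → x ∈ t₁.root ∨ x ∈ t₂.root) ∧
      t₁.ValidOn 𝓕 S R ∧ t₂.ValidOn 𝓕 S R

variable {𝓕 : Set (Set I)} {S : SearchProblem I O}

theorem Valid.validOn {t : FeasTree I} (R : Set I) (h : t.Valid 𝓕 S) : t.ValidOn 𝓕 S R := by
  induction t with
  | leaf f => exact ⟨h.1, h.2.imp fun o ho x _ hx => ho x hx⟩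
  | node₁ f t ih => exact ⟨h.1, fun x _ hx => h.2.1 hx, ih h.2.2⟩
  | node₂ f t₁ t₂ ih₁ ih₂ =>
    exact ⟨h.1, fun x _ hx => h.2.1 hx, ih₁ h.2.2.1, ih₂ h.2.2.2⟩

theorem ValidOn.mono {t : FeasTree I} {R R' : Set I} (hR : R' ⊆ R) (h : t.ValidOn 𝓕 S R) :
    t.ValidOn 𝓕 S R' := by
  induction t with
  | leaf f => exact ⟨h.1, h.2.imp fun o ho x hxR hx => ho x (hR hxR) hx⟩
  | node₁ f t ih => exact ⟨h.1, fun x hxR hx => h.2.1 x (hR hxR) hx, ih h.2.2⟩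
  | node₂ f t₁ t₂ ih₁ ih₂ =>
    exact ⟨h.1, fun x hxR hx => h.2.1 x (hR hxR) hx, ih₁ h.2.2.1, ih₂ h.2.2.2⟩

theorem ValidOn.root_mem {t : FeasTree I} {R : Set I} (h : t.ValidOn 𝓕 S R) : t.root ∈ 𝓕 := by
  cases t <;> exact h.1

/-- A tree with more than `a` vertices has a subtree `u` with between `a / 2` and `a` vertices;
`t'` is the tree without `u`. -/
theorem exists_separator [Nonempty O] (𝓕 : Set (Set I)) (S : SearchProblem I O) {a : ℕ}
    (ha : 1 ≤ a) (t : FeasTree I) : a < t.size → ∃ u t' : FeasTree I, u.size ≤ a ∧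
      a ≤ 2 * u.size ∧ t'.size + u.size ≤ t.size ∧ t'.root = t.root ∧
      ∀ R : Set I, t.ValidOn 𝓕 S R → u.ValidOn 𝓕 S R ∧
        ((∀ x ∈ R, x ∉ u.root) → t'.ValidOn 𝓕 S R) := by
  induction t with
  | leaf f => intro h; simp only [size] at h; omega
  | node₁ f t ih =>
    intro h
    simp only [size] at h
    by_cases ht : t.size ≤ a
    -- Cutting off the only child leaves a leaf that no input of `R` reaches, so any output is
    -- correct there.
    · refine ⟨t, leaf f, ht, by omega, by simp only [size]; omega, rfl, fun R hR =>
        ⟨hR.2.2, fun hu => ⟨hR.1, Classical.arbitrary O, fun x hxR hx =>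
          absurd (hR.2.1 x hxR hx) (hu x hxR)⟩⟩⟩
    · obtain ⟨u, t', h1, h2, h3, h4, h5⟩ := ih (by omega)
      refine ⟨u, node₁ f t', h1, h2, by simp only [size]; omega, rfl, fun R hR =>
        ⟨(h5 R hR.2.2).1, fun hu => ⟨hR.1, ?_, (h5 R hR.2.2).2 hu⟩⟩⟩
      rw [h4]; exact hR.2.1
  | node₂ f t₁ t₂ ih₁ ih₂ =>
    intro h
    simp only [size] at h
    by_cases h₁ : t₁.size ≤ a
    · by_cases h₂ : t₂.size ≤ a
      · rcases le_total t₁.size t₂.size with hle | hle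
        · refine ⟨t₂, node₁ f t₁, h₂, by omega, by simp only [size]; omega, rfl, fun R hR =>
            ⟨hR.2.2.2, fun hu => ⟨hR.1, fun x hxR hx => ?_, hR.2.2.1⟩⟩⟩
          exact (hR.2.1 x hxR hx).resolve_right (hu x hxR)
        · refine ⟨t₁, node₁ f t₂, h₁, by omega, by simp only [size]; omega, rfl, fun R hR =>
            ⟨hR.2.2.1, fun hu => ⟨hR.1, fun x hxR hx => ?_, hR.2.2.2⟩⟩⟩
          exact (hR.2.1 x hxR hx).resolve_left (hu x hxR)
      · obtain ⟨u, t', h1, h2, h3, h4, h5⟩ := ih₂ (by omega)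
        refine ⟨u, node₂ f t₁ t', h1, h2, by simp only [size]; omega, rfl, fun R hR =>
          ⟨(h5 R hR.2.2.2).1, fun hu => ⟨hR.1, ?_, hR.2.2.1, (h5 R hR.2.2.2).2 hu⟩⟩⟩
        rw [h4]; exact hR.2.1
    · obtain ⟨u, t', h1, h2, h3, h4, h5⟩ := ih₁ (by omega)
      refine ⟨u, node₂ f t' t₂, h1, h2, by simp only [size]; omega, rfl, fun R hR =>
        ⟨(h5 R hR.2.2.1).1, fun hu => ⟨hR.1, ?_, (h5 R hR.2.2.1).2 hu, hR.2.2.2⟩⟩⟩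
      rw [h4]; exact hR.2.1

/-- If the adversary can answer `r` queries to sets of `𝓕` while keeping the remaining inputs
without a common output, then every `𝓕`-tree has size exponential in `r`. -/
theorem pow_le_size [Nonempty O] (Good : ℕ → Set I → Prop)
    (hstep : ∀ r R, Good (r + 1) R → ∀ f ∈ 𝓕, ∃ R' ⊆ R, Good r R' ∧
      (R' ⊆ f ∨ ∀ x ∈ R', x ∉ f))
    (hend : ∀ r R, Good r R → ∀ o, ∃ x ∈ R, ¬ S x o) (r : ℕ) :
    ∀ (R : Set I) (t : FeasTree I), Good r R → R ⊆ t.root → t.ValidOn 𝓕 S R →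
      (4 / 3 : ℝ) ^ r ≤ t.size := by
  induction r with
  | zero =>
    intro R t _ _ _
    simpa using t.one_le_size
  | succ r ih =>
    intro R t hG hR ht
    by_cases hs : t.size ≤ 1
    · exfalso
      cases t with
      | leaf f =>
        obtain ⟨o, ho⟩ := ht.2
        obtain ⟨x, hx, hxo⟩ := hend _ _ hG o
        exact hxo (ho x hx (hR hx))
      | node₁ f t => have := t.one_le_size; simp only [size] at hs; omega
      | node₂ f t₁ t₂ => have := t₁.one_le_size; simp only [size] at hs; omega
    -- The separator has at most three quarters of the vertices and, after rounding, at least one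
    -- quarter; either answer therefore shrinks the tree by a factor `3 / 4`.
    obtain ⟨u, t', h1, h2, h3, h4, h5⟩ := exists_separator 𝓕 S (a := 3 * t.size / 4)
      (by omega) t (by omega)
    have hu : 4 * u.size ≤ 3 * t.size := by omega
    have ht' : 4 * t'.size ≤ 3 * t.size := by omega
    obtain ⟨R', hR', hG', hf⟩ := hstep r R hG u.root (h5 R ht).1.root_mem
    rw [pow_succ]
    rcases hf with hf | hf
    · have := ih R' u hG' hf ((h5 R ht).1.mono hR')
      have hu' : 4 * (u.size : ℝ) ≤ 3 * t.size := by exact_mod_cast hu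
      linarith
    · have := ih R' t' hG' (by rw [h4]; exact hR'.trans hR)
        ((h5 R' (ht.mono hR')).2 hf)
      have hu' : 4 * (t'.size : ℝ) ≤ 3 * t.size := by exact_mod_cast ht'
      linarith

end FeasTree

/-! ### The adversary -/

/-- The median is the largest value that at least half of the elements reach. If more than half
exceeded it strictly, the least of those would be a larger such value. -/
theorem exists_median {α : Type} (X : Finset α) (hX : X.Nonempty) (A : α → ℝ) :
    ∃ a, X.card ≤ 2 * (X.filter fun x => a ≤ A x).card ∧
      X.card ≤ 2 * (X.filter fun x => A x ≤ a).card := by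
  classical
  set S := X.filter fun x => X.card ≤ 2 * (X.filter fun x' => A x ≤ A x').card with hS
  have hSne : S.Nonempty := by
    obtain ⟨x, hx, hmin⟩ := X.exists_min_image A hX
    refine ⟨x, Finset.mem_filter.2 ⟨hx, ?_⟩⟩
    rw [Finset.filter_true_of_mem hmin]; omega
  obtain ⟨x₁, hx₁, hmax⟩ := S.exists_max_image A hSne
  refine ⟨A x₁, (Finset.mem_filter.1 hx₁).2, ?_⟩
  by_contra! hlt
  have hcard := Finset.card_filter_add_card_filter_not (s := X) (fun x => A x ≤ A x₁)
  have hne : (X.filter fun x => ¬ A x ≤ A x₁).Nonempty := by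
    rw [← Finset.card_pos]; omega
  obtain ⟨x₂, hx₂, hmin⟩ := Finset.exists_min_image _ A hne
  have hx₂' := (Finset.mem_filter.1 hx₂)
  have : x₂ ∈ S := by
    refine Finset.mem_filter.2 ⟨hx₂'.1, ?_⟩
    have hsub : (X.filter fun x => ¬ A x ≤ A x₁) ⊆ X.filter fun x' => A x₂ ≤ A x' :=
      fun x hx => Finset.mem_filter.2 ⟨(Finset.mem_filter.1 hx).1, hmin x hx⟩
    have := Finset.card_le_card hsub
    omega
  exact hx₂'.2 (hmax x₂ this)

/-- A rectangle has a quarter on which a given threshold query is constant. -/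
theorem exists_constant_quarter {α β : Type} (X : Finset α) (hX : X.Nonempty) (Y : Finset β)
    (hY : Y.Nonempty) (A : α → ℝ) (B : β → ℝ) (t : ℝ) :
    ∃ X₁ ⊆ X, ∃ Y₁ ⊆ Y, X.card ≤ 2 * X₁.card ∧ Y.card ≤ 2 * Y₁.card ∧
      ((∀ x ∈ X₁, ∀ y ∈ Y₁, t ≤ A x + B y) ∨ ∀ x ∈ X₁, ∀ y ∈ Y₁, ¬ t ≤ A x + B y) := by
  obtain ⟨a, ha1, ha2⟩ := exists_median X hX A
  obtain ⟨b, hb1, hb2⟩ := exists_median Y hY B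
  -- Either the two upper halves give the answer true throughout, or the two lower halves give
  -- false.
  by_cases h : t ≤ a + b
  · refine ⟨_, Finset.filter_subset _ _, _, Finset.filter_subset _ _, ha1, hb1, Or.inl ?_⟩
    intro x hx y hy
    have := (Finset.mem_filter.1 hx).2
    have := (Finset.mem_filter.1 hy).2
    linarith
  · refine ⟨_, Finset.filter_subset _ _, _, Finset.filter_subset _ _, ha2, hb2, Or.inr ?_⟩
    intro x hx y hy
    have := (Finset.mem_filter.1 hx).2
    have := (Finset.mem_filter.1 hy).2
    linarith

/-! ### Blockwise dense rectangles and their maintenance -/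

section Rect

variable {V M : Type} [DecidableEq V] [DecidableEq M] [Fintype V] [Fintype M]

/-- Outside the blocks `I`, no partial assignment of `X` is much more popular than under the
uniform distribution: `X` is blockwise dense. -/
def Spread (κ : ℝ) (X : Finset (V → M)) (I : Finset V) : Prop :=
  ∀ T, Disjoint T I → ∀ x₀ : V → M,
    ((X.filter fun x => ∀ v ∈ T, x v = x₀ v).card : ℝ) * κ ^ T.card ≤ X.card

/-- Density restoration. -/
theorem exists_spread_parts {κ : ℝ} (hκ : 0 < κ) (X : Finset (V → M))
    (I : Finset V) : ∃ X' ⊆ X, X.card ≤ 2 * X'.card ∧ ∀ x ∈ X', ∃ (J : Finset V)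
      (P : Finset (V → M)), Disjoint J I ∧ P ⊆ X ∧ (∀ x' ∈ P, ∀ v ∈ J, x' v = x v) ∧
        Spread κ P (I ∪ J) ∧ (X.card : ℝ) ≤ 2 * (P.card * κ ^ J.card) := by
  classical
  set p : (V → M) → Prop := fun x => ∃ (J : Finset V)
    (P : Finset (V → M)), Disjoint J I ∧ P ⊆ X ∧ (∀ x' ∈ P, ∀ v ∈ J, x' v = x v) ∧
        Spread κ P (I ∪ J) ∧ (X.card : ℝ) ≤ 2 * (P.card * κ ^ J.card) with hp
  refine ⟨X.filter p, Finset.filter_subset _ _, ?_, fun x hx => (Finset.mem_filter.1 hx).2⟩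
  by_contra! hlt
  -- Suppose the elements without a part are the majority. A maximal `J` on which some pattern is
  -- too popular within `Z` yields a slice that is spread by maximality, hence a part for one of
  -- these elements.
  set Z := X.filter fun x => ¬ p x with hZ
  have hcard : (X.filter p).card + Z.card = X.card := Finset.card_filter_add_card_filter_not p
  have hZne : Z.Nonempty := by rw [← Finset.card_pos]; omega
  have hXZ : (X.card : ℝ) ≤ 2 * Z.card := by exact_mod_cast (by omega : X.card ≤ 2 * Z.card)
  obtain ⟨x₀, hx₀⟩ := hZne
  set 𝒥 := (Finset.univ : Finset (Finset V)).filter fun J => Disjoint J I ∧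
    ∃ x ∈ Z, (Z.card : ℝ) ≤ (Z.filter fun x' => ∀ v ∈ J, x' v = x v).card * κ ^ J.card with h𝒥
  have h𝒥ne : 𝒥.Nonempty := ⟨∅, by simp [h𝒥]; exact ⟨x₀, hx₀⟩⟩
  obtain ⟨J, hJ, hmax⟩ := 𝒥.exists_max_image Finset.card h𝒥ne
  simp only [h𝒥, Finset.mem_filter, Finset.mem_univ, true_and] at hJ hmax
  obtain ⟨hJI, x, hxZ, hle⟩ := hJ
  refine (Finset.mem_filter.1 hxZ).2 ⟨J, Z.filter fun x' => ∀ v ∈ J, x' v = x v, hJI,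
    (Finset.filter_subset _ _).trans (Finset.filter_subset _ _),
    fun x' hx' => (Finset.mem_filter.1 hx').2, ?_, by linarith⟩
  intro T hT x₁
  by_contra! hbig
  set P := Z.filter fun x' => ∀ v ∈ J, x' v = x v with hP
  rw [Finset.disjoint_union_right] at hT
  have hTne : T.Nonempty := by
    rw [Finset.nonempty_iff_ne_empty]
    rintro rfl
    simp at hbig
  have hne : (P.filter fun x => ∀ v ∈ T, x v = x₁ v).Nonempty := by
    rw [Finset.nonempty_iff_ne_empty]
    intro h
    rw [h] at hbig
    simp at hbig
    exact absurd hbig (not_lt.2 (by positivity))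
  obtain ⟨x₂, hx₂⟩ := hne
  rw [Finset.mem_filter] at hx₂
  have hx₂' := Finset.mem_filter.1 hx₂.1
  have hsub : (P.filter fun x => ∀ v ∈ T, x v = x₁ v) ⊆
      Z.filter fun x' => ∀ v ∈ J ∪ T, x' v = x₂ v := by
    intro x' hx'
    rw [Finset.mem_filter] at hx'
    have hx'' := Finset.mem_filter.1 hx'.1
    refine Finset.mem_filter.2 ⟨hx''.1, fun v hv => ?_⟩
    rcases Finset.mem_union.1 hv with hv | hv
    · rw [hx''.2 v hv, hx₂'.2 v hv]
    · rw [hx'.2 v hv, hx₂.2 v hv]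
  have hcardJT : (J ∪ T).card = J.card + T.card := Finset.card_union_of_disjoint hT.2.symm
  have := hmax (J ∪ T) ⟨Finset.disjoint_union_left.2 ⟨hJI, hT.1⟩, x₂, hx₂'.1, ?_⟩
  · have := hTne.card_pos
    omega
  · rw [hcardJT, pow_add]
    have h1 : (((P.filter fun x => ∀ v ∈ T, x v = x₁ v).card : ℕ) : ℝ) ≤
        (Z.filter fun x' => ∀ v ∈ J ∪ T, x' v = x₂ v).card := by
      exact_mod_cast Finset.card_le_card hsub
    have hJ0 : 0 < κ ^ J.card := by positivity
    have hT0 : 0 < κ ^ T.card := by positivity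
    calc (Z.card : ℝ) ≤ P.card * κ ^ J.card := hle
      _ ≤ (((P.filter fun x => ∀ v ∈ T, x v = x₁ v).card : ℕ) * κ ^ T.card) * κ ^ J.card := by
          gcongr
      _ ≤ ((Z.filter fun x' => ∀ v ∈ J ∪ T, x' v = x₂ v).card * κ ^ T.card) * κ ^ J.card := by
          gcongr
      _ = _ := by ring

theorem card_mul_pow_le (X : Finset (V → M)) (I : Finset V)
    (h : ∀ x ∈ X, ∀ x' ∈ X, ∀ v ∈ I, x v = x' v) :
    X.card * Fintype.card M ^ I.card ≤ Fintype.card M ^ Fintype.card V := by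
  rcases X.eq_empty_or_nonempty with rfl | ⟨x₀, hx₀⟩
  · simp
  have hsub : X ⊆ Fintype.piFinset fun v => if v ∈ I then {x₀ v} else Finset.univ := by
    intro x hx
    rw [Fintype.mem_piFinset]
    intro v
    split_ifs with hv
    · simpa using h x hx x₀ hx₀ v hv
    · simp
  have h1 := Finset.card_le_card hsub
  rw [Fintype.card_piFinset] at h1
  have h2 : Fintype.card M ^ I.card = ∏ v : V, if v ∈ I then Fintype.card M else 1 := by
    rw [Finset.prod_ite_mem, Finset.univ_inter, Finset.prod_const]
  calc _ ≤ _ := Nat.mul_le_mul_right _ h1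
    _ = ∏ v : V, Fintype.card M := by
        rw [h2, ← Finset.prod_mul_distrib]
        refine Finset.prod_congr rfl fun v _ => ?_
        split_ifs <;> simp
    _ = _ := by simp

/-- The invariant of the adversary: after `q - r` threshold queries the variables in `I` have been
answered by `z`, which leaves a hard subcube, and the remaining inputs form the large rectangle
`X × Y`. -/
structure GoodRect (F : CNF V) (d q : ℕ) (κ : ℝ) (r : ℕ) (X : Finset (V → M))
    (Y : Finset (V × M → Bool)) (I : Finset V) (z : V → Bool) (k : ℕ) : Prop where
  le : r ≤ q
  budget : k + I.card + 1 = d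
  hard : ¬ Solv F.search k I z
  const : ∀ x ∈ X, ∀ x' ∈ X, ∀ v ∈ I, x v = x' v
  agree : ∀ x ∈ X, ∀ y ∈ Y, ∀ v ∈ I, y (v, x v) = z v
  spread : Spread κ X I
  large_X : (Fintype.card M : ℝ) ^ Fintype.card V ≤ X.card * 4 ^ (q - r) * κ ^ I.card
  large_Y : (2 : ℝ) ^ Fintype.card (V × M) ≤ Y.card * 4 ^ (q - r) * 2 ^ I.card

variable {F : CNF V} {d q : ℕ} {κ : ℝ}

/-- Fixing a block divides the space by `κ ^ 2`, but the invariant allows only a loss of `κ` per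
block; the remaining `κ` must be paid from the losses in the queries. -/
theorem pow_le_of_large {X : Finset (V → M)} {I : Finset V} {s : ℕ} (hκ : 0 < κ)
    (hM : (Fintype.card M : ℝ) = κ ^ 2) (hc : ∀ x ∈ X, ∀ x' ∈ X, ∀ v ∈ I, x v = x' v)
    (hl : (Fintype.card M : ℝ) ^ Fintype.card V ≤ X.card * 4 ^ s * κ ^ I.card) :
    κ ^ I.card ≤ 4 ^ s := by
  have h1 : (X.card : ℝ) * Fintype.card M ^ I.card ≤ Fintype.card M ^ Fintype.card V := by
    exact_mod_cast card_mul_pow_le X I hc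
  have hX : 0 < (X.card : ℝ) := by
    by_contra h
    have : (X.card : ℝ) = 0 := le_antisymm (not_lt.1 h) (by positivity)
    rw [this, hM, zero_mul, zero_mul] at hl
    exact absurd hl (not_le.2 (by positivity))
  have h2 := h1.trans hl
  rw [hM, ← pow_mul, mul_comm 2, pow_mul, sq, mul_assoc] at h2
  have h3 := le_of_mul_le_mul_left h2 hX
  exact le_of_mul_le_mul_right h3 (by positivity)

/-- The numerical conditions on the parameters: `κ` is the square root of the number of cells. -/
structure Params (M : Type) [Fintype M] (d q : ℕ) (κ : ℝ) : Prop where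
  card_eq : (Fintype.card M : ℝ) = κ ^ 2
  le : 400 * (3 * q + 1) * (q + 1) ≤ κ
  lt : (4 : ℝ) ^ q < κ ^ d

theorem Params.four_le (hP : Params M d q κ) : 4 ≤ κ := by
  have h1 := hP.le
  have h2 : (0 : ℝ) ≤ q := by positivity
  nlinarith

/-- Applied to the number of fixed blocks: `i ≤ q` limits the shrinking of `Y`, and `i < d` keeps
the adversary's depth budget from running out. -/
theorem Params.card_le (hP : Params M d q κ) {i s : ℕ} (hs : s ≤ q) (h : κ ^ i ≤ 4 ^ s) :
    i ≤ q ∧ i < d := by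
  have h4 := hP.four_le
  have h1 : κ ^ i ≤ 4 ^ q := h.trans (pow_le_pow_right₀ (by norm_num) hs)
  constructor
  · have : (4 : ℝ) ^ i ≤ 4 ^ q := (pow_le_pow_left₀ (by norm_num) h4 i).trans h1
    exact (pow_le_pow_iff_right₀ (by norm_num)).1 this
  · exact (pow_lt_pow_iff_right₀ (by linarith)).1 (h1.trans_lt hP.lt)

namespace GoodRect

variable {r k : ℕ} {X : Finset (V → M)} {Y : Finset (V × M → Bool)} {I : Finset V}
  {z : V → Bool}

theorem nonempty_X (hP : Params M d q κ) (h : GoodRect F d q κ r X Y I z k) : X.Nonempty := by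
  rw [Finset.nonempty_iff_ne_empty]
  rintro rfl
  have h1 := h.large_X
  have := hP.four_le
  rw [hP.card_eq, Finset.card_empty, Nat.cast_zero, zero_mul, zero_mul] at h1
  exact absurd h1 (not_le.2 (by positivity))

theorem nonempty_Y (h : GoodRect F d q κ r X Y I z k) : Y.Nonempty := by
  rw [Finset.nonempty_iff_ne_empty]
  rintro rfl
  have h1 := h.large_Y
  rw [Finset.card_empty, Nat.cast_zero, zero_mul, zero_mul] at h1
  exact absurd h1 (not_le.2 (by positivity))

/-- At most `q` blocks are fixed, so `Y` has lost at most `2q + q` bits. This is the deficit passed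
to `exists_compatible`. -/
theorem dense (hP : Params M d q κ) (h : GoodRect F d q κ r X Y I z k) :
    (4 : ℝ) ^ (q - r) * 2 ^ I.card ≤ 2 ^ (3 * q) := by
  have h1 := (hP.card_le (Nat.sub_le q r) (pow_le_of_large (by linarith [hP.four_le]) hP.card_eq
    h.const h.large_X)).1
  rw [show (4 : ℝ) = 2 ^ 2 by norm_num, ← pow_mul, ← pow_add]
  exact pow_le_pow_right₀ (by norm_num) (by omega)

/-- The adversary answers a threshold query. -/
theorem step (hP : Params M d q κ) (h : GoodRect F d q κ (r + 1) X Y I z k)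
    (A : (V → M) → ℝ) (B : (V × M → Bool) → ℝ) (t : ℝ) :
    ∃ X' ⊆ X, ∃ Y' ⊆ Y, (∃ I' z' k', GoodRect F d q κ r X' Y' I' z' k') ∧
      ((∀ x ∈ X', ∀ y ∈ Y', t ≤ A x + B y) ∨ ∀ x ∈ X', ∀ y ∈ Y', ¬ t ≤ A x + B y) := by
  have hκ4 := hP.four_le
  have hκ0 : 0 < κ := by linarith
  obtain ⟨X₁, hX₁, Y₁, hY₁, hcX, hcY, hconst⟩ :=
    exists_constant_quarter X (h.nonempty_X hP) Y h.nonempty_Y A B t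
  obtain ⟨X₂, hX₂, hcX₂, hparts⟩ := exists_spread_parts hκ0 X₁ I
  have hcX' : (X.card : ℝ) ≤ 2 * X₁.card := by exact_mod_cast hcX
  have hcX₂' : (X₁.card : ℝ) ≤ 2 * X₂.card := by exact_mod_cast hcX₂
  have hcY' : (Y.card : ℝ) ≤ 2 * Y₁.card := by exact_mod_cast hcY
  have hqr : (4 : ℝ) ^ (q - r) = 4 * 4 ^ (q - (r + 1)) := by
    rw [← pow_succ']; congr 1; have := h.le; omega
  -- Every candidate `x` gets its own new blocks, part and hard answers. Only afterwards is an `x`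
  -- chosen whose answers `Y` can accommodate.
  have hex : ∀ x ∈ X₂, ∃ (J : Finset V) (P : Finset (V → M)) (w : V → Bool) (k' : ℕ),
      Disjoint J I ∧ P ⊆ X₁ ∧ (∀ x' ∈ P, ∀ v ∈ J, x' v = x v) ∧ Spread κ P (I ∪ J) ∧
      (Fintype.card M : ℝ) ^ Fintype.card V ≤ P.card * 4 ^ (q - r) * κ ^ (I ∪ J).card ∧
      J.card ≤ q ∧ k' + (I ∪ J).card + 1 = d ∧ (∀ v ∈ I, w v = z v) ∧
      ¬ Solv F.search k' (I ∪ J) w := by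
    intro x hx
    obtain ⟨J, P, hJ, hP1, hP2, hP3, hP4⟩ := hparts x hx
    have hcJ : (I ∪ J).card = I.card + J.card := Finset.card_union_of_disjoint hJ.symm
    have hl : (Fintype.card M : ℝ) ^ Fintype.card V ≤
        P.card * 4 ^ (q - r) * κ ^ (I ∪ J).card := by
      refine h.large_X.trans ?_
      rw [hqr, hcJ, pow_add]
      calc (X.card : ℝ) * 4 ^ (q - (r + 1)) * κ ^ I.card
          ≤ (2 * (2 * (P.card * κ ^ J.card))) * 4 ^ (q - (r + 1)) * κ ^ I.card := by
            gcongr; linarith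
        _ = _ := by ring
    have hcon : ∀ x ∈ P, ∀ x' ∈ P, ∀ v ∈ I ∪ J, x v = x' v := by
      intro y hy y' hy' v hv
      rcases Finset.mem_union.1 hv with hv | hv
      · exact h.const y (hX₁ (hP1 hy)) y' (hX₁ (hP1 hy')) v hv
      · rw [hP2 y hy v hv, hP2 y' hy' v hv]
    have hsmall := hP.card_le (Nat.sub_le q r) (pow_le_of_large hκ0 hP.card_eq hcon hl)
    have hb := h.budget
    obtain ⟨k', rfl⟩ : ∃ k', k = k' + J.card := ⟨k - J.card, by omega⟩
    obtain ⟨w, hw1, hw2⟩ := Solv.exists_hard_answers J hJ h.hard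
    exact ⟨J, P, w, k', hJ, hP1, hP2, hP3, hl, by omega, by omega, hw1, hw2⟩
  choose! J P w k' hJ hP1 hP2 hP3 hP4 hP5 hP6 hP7 hP8 using hex
  have hX₂ne : X₂.Nonempty := by
    have := (h.nonempty_X hP).card_pos
    rw [← Finset.card_pos]; omega
  -- One bit beyond `3q`, since `Y₁` may be only half of `Y`.
  have hYd : (2 : ℝ) ^ Fintype.card (V × M) ≤ Y₁.card * 2 ^ (3 * q + 1 : ℝ) := by
    rw [show (3 * q + 1 : ℝ) = ((3 * q + 1 : ℕ) : ℝ) by push_cast; ring, Real.rpow_natCast]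
    calc _ ≤ (Y.card : ℝ) * (4 ^ (q - (r + 1)) * 2 ^ I.card) := by
          rw [← mul_assoc]; exact h.large_Y
      _ ≤ (2 * Y₁.card) * 2 ^ (3 * q) := by
          gcongr
          exact h.dense hP
      _ = _ := by rw [pow_succ]; ring
  have hq0 : (0 : ℝ) ≤ q := by positivity
  -- `X₂` contains at least a quarter of the spread set `X`, which accounts for the factor 4 in the
  -- hypothesis of `exists_compatible`.
  obtain ⟨x, hx, hxY⟩ := exists_compatible X₂ hX₂ne I (κ := κ) (Δ := 3 * q + 1) (K := q + 1)
    (by linarith) hκ0 (by have := hP.le; push_cast; linarith) (fun T hT x₀ => by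
      refine le_trans ?_ ((h.spread T hT x₀).trans (by linarith))
      gcongr ?_ * _
      exact_mod_cast Finset.card_le_card (Finset.filter_subset_filter _ (hX₂.trans hX₁))) J hJ (fun x hx => (hP5 x hx).trans (Nat.le_succ q)) w Y₁ hYd
  refine ⟨P x, (hP1 x hx).trans hX₁, Y₁.filter fun y => ∀ v ∈ J x, y (v, x v) = w x v,
    (Finset.filter_subset _ _).trans hY₁, ⟨I ∪ J x, w x, k' x, ?_⟩, ?_⟩
  · refine ⟨(Nat.le_succ r).trans h.le, hP6 x hx, hP8 x hx, ?_, ?_, hP3 x hx, hP4 x hx, ?_⟩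
    · intro y hy y' hy' v hv
      rcases Finset.mem_union.1 hv with hv | hv
      · exact h.const y (hX₁ (hP1 x hx hy)) y' (hX₁ (hP1 x hx hy')) v hv
      · rw [hP2 x hx y hy v hv, hP2 x hx y' hy' v hv]
    · intro x' hx' y hy v hv
      have hy' := Finset.mem_filter.1 hy
      rcases Finset.mem_union.1 hv with hv | hv
      · rw [hP7 x hx v hv]
        exact h.agree x' (hX₁ (hP1 x hx hx')) y (hY₁ hy'.1) v hv
      · rw [hP2 x hx x' hx' v hv]
        exact hy'.2 v hv
    · have hcJ : (I ∪ J x).card = I.card + (J x).card :=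
        Finset.card_union_of_disjoint (hJ x hx).symm
      refine h.large_Y.trans ?_
      rw [hqr, hcJ, pow_add]
      rw [pow_succ] at hxY
      calc (Y.card : ℝ) * 4 ^ (q - (r + 1)) * 2 ^ I.card
          ≤ (2 * (2 ^ (J x).card * 2 *
              (Y₁.filter fun y => ∀ v ∈ J x, y (v, x v) = w x v).card)) *
              4 ^ (q - (r + 1)) * 2 ^ I.card := by
            gcongr; linarith
        _ = _ := by ring
  · rcases hconst with hc | hc
    · exact Or.inl fun x' hx' y hy => hc x' (hP1 x hx hx') y (Finset.mem_filter.1 hy).1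
    · exact Or.inr fun x' hx' y hy => hc x' (hP1 x hx hx') y (Finset.mem_filter.1 hy).1

/-- No clause is falsified on the whole rectangle. -/
theorem exists_not_falsified (hP : Params M d q κ) (h : GoodRect F d q κ r X Y I z k)
    {D : Clause V} (hD : D ∈ F) :
    ∃ x ∈ X, ∃ y ∈ Y, ¬ D.Falsified fun v => y (v, x v) := by
  have hκ0 : 0 < κ := by linarith [hP.four_le]
  -- A hard subcube has no clause falsified throughout, so some literal of `D` is true under `z` or
  -- has a free variable. In the free case one more block is made to satisfy it.
  obtain ⟨x₀, hx₀, hD'⟩ : ∃ x₀ : V → Bool, (∀ v ∈ I, x₀ v = z v) ∧ ¬ D.Falsified x₀ := by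
    by_contra! hc
    exact h.hard (Solv.mono_depth (Nat.zero_le k) ⟨⟨D, hD⟩, hc⟩)
  simp only [Clause.Falsified, not_forall, not_not] at hD'
  obtain ⟨l, hl, hlx⟩ := hD'
  suffices ∃ x ∈ X, ∃ y ∈ Y, y (l.1, x l.1) = l.2 by
    obtain ⟨x, hx, y, hy, hxy⟩ := this
    exact ⟨x, hx, y, hy, fun hf => hf l hl hxy⟩
  by_cases hlI : l.1 ∈ I
  · obtain ⟨x, hx⟩ := h.nonempty_X hP
    obtain ⟨y, hy⟩ := h.nonempty_Y
    exact ⟨x, hx, y, hy, by rw [h.agree x hx y hy _ hlI, ← hx₀ _ hlI, hlx]⟩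
  · have hYd : (2 : ℝ) ^ Fintype.card (V × M) ≤ Y.card * 2 ^ (3 * q + 1 : ℝ) := by
      rw [show (3 * q + 1 : ℝ) = ((3 * q + 1 : ℕ) : ℝ) by push_cast; ring, Real.rpow_natCast]
      calc _ ≤ (Y.card : ℝ) * (4 ^ (q - r) * 2 ^ I.card) := by
            rw [← mul_assoc]; exact h.large_Y
        _ ≤ Y.card * 2 ^ (3 * q) := by
            gcongr
            exact h.dense hP
        _ ≤ _ := mul_le_mul_of_nonneg_left (pow_le_pow_right₀ one_le_two (Nat.le_succ _))
            (Nat.cast_nonneg _)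
    have hq0 : (0 : ℝ) ≤ q := by positivity
    -- `K = q + 1` leaves room for one block even when `q = 0`.
    obtain ⟨x, hx, hxY⟩ := exists_compatible X (h.nonempty_X hP) I (κ := κ) (Δ := 3 * q + 1)
      (K := q + 1) (by linarith) hκ0 (by have := hP.le; push_cast; linarith)
      (fun T hT x₀ => (h.spread T hT x₀).trans
        (by have : (0 : ℝ) ≤ X.card := by positivity
            linarith))
      (fun _ => {l.1}) (fun _ _ => by simpa using hlI) (fun _ _ => by simp)
      (fun _ _ => l.2) Y hYd
    have hne : (Y.filter fun y => ∀ v ∈ ({l.1} : Finset V), y (v, x v) = l.2).Nonempty := by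
      rw [Finset.nonempty_iff_ne_empty]
      intro he
      rw [he] at hxY
      simp at hxY
      exact h.nonempty_Y.ne_empty hxY
    obtain ⟨y, hy⟩ := hne
    rw [Finset.mem_filter] at hy
    exact ⟨x, hx, y, hy.1, hy.2 _ (by simp)⟩

theorem init (hP : Params M d q κ) (hd : ¬ Solv F.search (d - 1) ∅ z) (hd0 : 0 < d) :
    GoodRect F d q κ q (Finset.univ : Finset (V → M)) Finset.univ ∅ z (d - 1) := by
  have hκ4 := hP.four_le
  refine ⟨le_rfl, by simp; omega, hd, by simp, by simp, ?_, by simp, by simp⟩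
  intro T _ x₀
  have h1 : (((Finset.univ : Finset (V → M)).filter fun x => ∀ v ∈ T, x v = x₀ v).card : ℝ) *
      Fintype.card M ^ T.card ≤ Fintype.card M ^ Fintype.card V := by
    exact_mod_cast card_mul_pow_le _ T (fun x hx x' hx' v hv => by
      rw [(Finset.mem_filter.1 hx).2 v hv, (Finset.mem_filter.1 hx').2 v hv])
  have h2 : ((Finset.univ : Finset (V → M)).card : ℝ) = Fintype.card M ^ Fintype.card V := by
    simp
  rw [h2]
  refine le_trans ?_ h1
  gcongr
  rw [hP.card_eq]; nlinarith

end GoodRect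

end Rect

/-! ### Proof systems and trees -/

section Proofs

variable {V : Type} [Fintype V] [DecidableEq V]

/-- A negative literal contributes `1 - x v`; moving these constants to the left leaves the count of
true literals. Count at least 1 is the clause, count at least `D.card` the conjunction. -/
theorem Clause.sum_toLine (D : Clause V) (x : V → Bool) :
    (∑ v, if x v then D.toLine.a v else 0) + ((D.filter fun l => l.2 = false).card : ℤ) =
      (D.filter fun l => x l.1 = l.2).card := by
  have h1 : ∀ p : Literal V → Prop, ∀ _ : DecidablePred p,
      ((D.filter p).card : ℤ) = ∑ v, ∑ b, if (v, b) ∈ D ∧ p (v, b) then 1 else 0 := by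
    intro p _
    rw [← Fintype.sum_prod_type (f := fun l : V × Bool => if l ∈ D ∧ p l then (1 : ℤ) else 0),
      Finset.sum_boole]
    congr 2
    ext l; simp
  rw [h1, h1, ← Finset.sum_add_distrib]
  refine Finset.sum_congr rfl fun v _ => ?_
  simp only [Clause.toLine, Fintype.sum_bool]
  cases x v <;> by_cases ht : (v, true) ∈ D <;> by_cases hf : (v, false) ∈ D <;> simp [ht, hf]

theorem Clause.toLine_holds {D : Clause V} {x : V → Bool} :
    D.toLine.Holds x ↔ ∃ l ∈ D, x l.1 = l.2 := by
  have h1 := D.sum_toLine x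
  have h2 : D.toLine.b = 1 - ((D.filter fun l => l.2 = false).card : ℤ) := rfl
  have h3 : D.toLine.Holds x ↔ 1 ≤ (D.filter fun l => x l.1 = l.2).card := by
    unfold Line.Holds
    rw [h2]
    omega
  rw [h3, Nat.succ_le_iff, Finset.card_pos]
  simp [Finset.Nonempty, Finset.mem_filter]

theorem conjunctions_subset_thresholds : conjunctions V ⊆ thresholds V := by
  rintro _ ⟨C, rfl⟩
  refine ⟨fun v => (Clause.toLine C).a v,
    C.card - ((C.filter fun l => l.2 = false).card : ℝ), ?_⟩
  ext x
  have h1 : (∑ v, if x v then ((Clause.toLine C).a v : ℝ) else 0) +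
      ((C.filter fun l => l.2 = false).card : ℝ) = (C.filter fun l => x l.1 = l.2).card := by
    exact_mod_cast Clause.sum_toLine C x
  have h2 : (∀ l ∈ C, x l.1 = l.2) ↔ C.card ≤ (C.filter fun l => x l.1 = l.2).card := by
    rw [← Finset.filter_eq_self]
    refine ⟨fun h => by rw [h], fun h => Finset.eq_of_subset_of_card_le (Finset.filter_subset _ _) h⟩
  have h3 : (∀ l ∈ C, x l.1 = l.2) ↔ (C.card : ℝ) ≤ (C.filter fun l => x l.1 = l.2).card := by
    rw [h2, Nat.cast_le]
  simp only [Set.mem_ofPred_eq]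
  rw [h3, ← h1]
  exact (sub_le_iff_le_add).symm

theorem FeasTree.Valid.mono_family {I O : Type} {𝓕 𝓖 : Set (Set I)} (h : 𝓕 ⊆ 𝓖)
    {S : SearchProblem I O} {t : FeasTree I} (ht : t.Valid 𝓕 S) : t.Valid 𝓖 S := by
  induction t with
  | leaf f => exact ⟨h ht.1, ht.2⟩
  | node₁ f t ih => exact ⟨h ht.1, ht.2.1, ih ht.2.2⟩
  | node₂ f t₁ t₂ ih₁ ih₂ => exact ⟨h ht.1, ht.2.1, ih₁ ht.2.2.1, ih₂ ht.2.2.2⟩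

theorem ltfTree_le_decTree {O : Type} {S : SearchProblem (V → Bool) O} {k : ℕ} {z : V → Bool}
    (h : Solv S k ∅ z) : ltfTree S ≤ decTree S := by
  obtain ⟨t, ⟨h1, h2⟩, h3⟩ := Nat.sInf_mem (s := {s | ∃ t : FeasTree (V → Bool),
    t.Solves (conjunctions V) S ∧ t.size = s})
    (h.exists_decTree.imp' FeasTree.size fun t ht => ⟨t, ht.1, rfl⟩)
  exact Nat.sInf_le ⟨t, ⟨h1, h2.mono_family conjunctions_subset_thresholds⟩, h3⟩

/-- The derived clause is falsified on the whole subcube. No weakening is needed: if the queried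
variable is missing from a child's clause, that clause already serves the parent. -/
theorem Solv.exists_treeRes {G : CNF V} {k : ℕ} : ∀ {I : Finset V} {z : V → Bool},
    Solv G.search k I z → ∃ D L, TreeRes G D L ∧ (∀ l ∈ D, l.1 ∈ I ∧ l.2 = !z l.1) ∧
      L + 1 ≤ 2 ^ (k + 1) := by
  induction k with
  | zero =>
    rintro I z ⟨D, hD⟩
    refine ⟨D.1, 1, .initial _ D.2, fun l hl => ⟨?_, ?_⟩, by simp⟩
    · by_contra hlI
      have h1 := hD (Function.update z l.1 l.2) (fun v hv => by
        rw [Function.update_of_ne]; rintro rfl; exact hlI hv) l hl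
      simp at h1
    · have := hD z (fun _ _ => rfl) l hl
      revert this
      cases z l.1 <;> cases l.2 <;> simp
  | succ k ih =>
    rintro I z (h | ⟨v, hv⟩)
    · obtain ⟨D, L, h1, h2, h3⟩ := ih h
      exact ⟨D, L, h1, h2, by rw [pow_succ]; omega⟩
    obtain ⟨A, L₁, hA1, hA2, hA3⟩ := ih (hv false)
    obtain ⟨B, L₂, hB1, hB2, hB3⟩ := ih (hv true)
    have key : ∀ (b : Bool) (l : Literal V), l ≠ (v, !b) →
        (l.1 ∈ insert v I ∧ l.2 = !Function.update z v b l.1) → l.1 ∈ I ∧ l.2 = !z l.1 := by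
      rintro b ⟨u, a⟩ hne ⟨h1, h2⟩
      by_cases huv : u = v
      · subst huv
        simp only [Function.update_self] at h2
        exact absurd (by rw [h2]) hne
      · simp only [Function.update_of_ne huv] at h2
        exact ⟨by simpa [huv] using h1, h2⟩
    by_cases hAv : (v, true) ∈ A
    · by_cases hBv : (v, false) ∈ B
      · rw [← Finset.insert_erase hAv] at hA1
        rw [← Finset.insert_erase hBv] at hB1
        refine ⟨_, _, .resolve v _ _ _ _ hA1 hB1, fun l hl => ?_, by rw [pow_succ]; omega⟩
        rcases Finset.mem_union.1 hl with hl | hl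
        · exact key false l (Finset.ne_of_mem_erase hl) (hA2 l (Finset.mem_of_mem_erase hl))
        · exact key true l (Finset.ne_of_mem_erase hl) (hB2 l (Finset.mem_of_mem_erase hl))
      · exact ⟨B, L₂, hB1, fun l hl => key true l (by rintro rfl; exact hBv hl) (hB2 l hl),
          by rw [pow_succ]; omega⟩
    · exact ⟨A, L₁, hA1, fun l hl => key false l (by rintro rfl; exact hAv hl) (hA2 l hl),
        by rw [pow_succ]; omega⟩

theorem Solv.exists_refutation {G : CNF V} {k : ℕ} {z : V → Bool} (h : Solv G.search k ∅ z) :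
    ∃ L, TreeRes G ∅ L ∧ L + 1 ≤ 2 ^ (k + 1) := by
  obtain ⟨D, L, h1, h2, h3⟩ := h.exists_treeRes
  obtain rfl : D = ∅ := Finset.eq_empty_of_forall_notMem fun l hl => by simpa using (h2 l hl).1
  exact ⟨L, h1, h3⟩

theorem Solv.resTree_le {G : CNF V} {k : ℕ} {z : V → Bool} (h : Solv G.search k ∅ z) :
    resTree G + 1 ≤ 2 ^ (k + 1) := by
  obtain ⟨L, h1, h2⟩ := h.exists_refutation
  exact le_trans (by gcongr; exact Nat.sInf_le h1) h2

theorem TreeRes.treeCut {G : CNF V} {D : Clause V} {L : ℕ} (h : TreeRes G D L) :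
    TreeCut G D.toLine L := by
  induction h with
  | initial D h => exact .initial D h
  | resolve v A B L₁ L₂ _ _ ih₁ ih₂ =>
    refine .infer₂ _ _ _ _ _ ih₁ ih₂ fun x h₁ h₂ => ?_
    rw [Clause.toLine_holds] at *
    obtain ⟨l₁, hl₁, hx₁⟩ := h₁
    obtain ⟨l₂, hl₂, hx₂⟩ := h₂
    rcases Finset.mem_insert.1 hl₁ with rfl | hl₁
    · rcases Finset.mem_insert.1 hl₂ with rfl | hl₂
      · simp only at hx₁ hx₂; rw [hx₁] at hx₂; cases hx₂
      · exact ⟨l₂, Finset.mem_union_right _ hl₂, hx₂⟩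
    · exact ⟨l₁, Finset.mem_union_left _ hl₁, hx₁⟩

theorem Clause.toLine_empty : Clause.toLine (∅ : Clause V) = ⟨fun _ => 0, 1⟩ := by
  simp [Clause.toLine]

theorem cutTree_le_resTree {G : CNF V} {k : ℕ} {z : V → Bool} (h : Solv G.search k ∅ z) :
    cutTree G ≤ resTree G := by
  have h1 : TreeRes G ∅ (resTree G) :=
    Nat.sInf_mem (s := {L | TreeRes G ∅ L}) (h.exists_refutation.imp fun _ h => h.1)
  have h2 := h1.treeCut
  rw [Clause.toLine_empty] at h2
  exact Nat.sInf_le h2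

/-- Integrality turns the strict inequality of the negation into a non-strict one with bound `1 -
ℓ.b`. -/
theorem Line.not_holds_mem_thresholds (ℓ : Line V) :
    {x | ¬ ℓ.Holds x} ∈ thresholds V := by
  refine ⟨fun v => -(ℓ.a v : ℝ), 1 - ℓ.b, ?_⟩
  ext x
  have h1 : (∑ v, if x v then -(ℓ.a v : ℝ) else 0) =
      ((-∑ v, if x v then ℓ.a v else 0 : ℤ) : ℝ) := by
    push_cast
    rw [← Finset.sum_neg_distrib]
    exact Finset.sum_congr rfl fun v _ => by split_ifs <;> simp
  simp only [Set.mem_ofPred_eq]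
  rw [h1, show (1 - ℓ.b : ℝ) = ((1 - ℓ.b : ℤ) : ℝ) by push_cast; rfl, Int.cast_le]
  unfold Line.Holds
  omega

/-- The negations of the lines of a tree-like Cutting Planes derivation form an LTF-tree. -/
theorem TreeCut.exists_tree {O : Type} [Nonempty O] {G : CNF V} {S : SearchProblem (V → Bool) O}
    (hS : ∀ E ∈ G, ∃ o, ∀ x, Clause.Falsified E x → S x o) {ℓ : Line V} {L : ℕ}
    (h : TreeCut G ℓ L) : ∃ t : FeasTree (V → Bool), t.root = {x | ¬ ℓ.Holds x} ∧
      t.Valid (thresholds V) S ∧ t.size = L := by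
  induction h with
  | nonneg v =>
    -- An axiom holds everywhere, so its negation is empty and any output will do.
    refine ⟨.leaf _, rfl, ⟨Line.not_holds_mem_thresholds _, Classical.arbitrary O,
      fun x hx => absurd ?_ hx⟩, rfl⟩
    exact Finset.sum_nonneg fun w _ => by by_cases hw : w = v <;> cases x w <;> simp [hw]
  | le_one v =>
    refine ⟨.leaf _, rfl, ⟨Line.not_holds_mem_thresholds _, Classical.arbitrary O,
      fun x hx => absurd ?_ hx⟩, rfl⟩
    calc (-1 : ℤ) = ∑ w, if w = v then -1 else 0 := by simp
      _ ≤ _ := Finset.sum_le_sum fun w _ => by by_cases hw : w = v <;> cases x w <;> simp [hw]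
  | initial D hD =>
    obtain ⟨o, ho⟩ := hS D hD
    refine ⟨.leaf _, rfl, ⟨Line.not_holds_mem_thresholds _, o, fun x hx => ho x ?_⟩, rfl⟩
    simp only [Clause.toLine_holds, not_exists, not_and] at hx
    exact hx
  | infer₁ ℓ₁ ℓ L₁ _ hl ih =>
    obtain ⟨t, h1, h2, h3⟩ := ih
    refine ⟨.node₁ {x | ¬ ℓ.Holds x} t, rfl, ⟨Line.not_holds_mem_thresholds _, ?_, h2⟩,
      by simp [FeasTree.size, h3]⟩
    rw [h1]
    exact fun x hx hx' => hx (hl x hx')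
  | infer₂ ℓ₁ ℓ₂ ℓ L₁ L₂ _ _ hl ih₁ ih₂ =>
    obtain ⟨t₁, h1, h2, h3⟩ := ih₁
    obtain ⟨t₂, h1', h2', h3'⟩ := ih₂
    refine ⟨.node₂ {x | ¬ ℓ.Holds x} t₁ t₂, rfl, ⟨Line.not_holds_mem_thresholds _, ?_, h2, h2'⟩,
      by simp [FeasTree.size, h3, h3']⟩
    rw [h1, h1']
    intro x hx
    by_contra hc
    simp only [Set.mem_union, Set.mem_ofPred_eq, not_or, not_not] at hc
    exact hx (hl x hc.1 hc.2)

theorem ltfTree_le_cutTree {O : Type} [Nonempty O] {G : CNF V} {S : SearchProblem (V → Bool) O}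
    (hS : ∀ E ∈ G, ∃ o, ∀ x, Clause.Falsified E x → S x o) {k : ℕ} {z : V → Bool}
    (h : Solv G.search k ∅ z) : ltfTree S ≤ cutTree G := by
  have h1 : TreeCut G ⟨fun _ => 0, 1⟩ (cutTree G) := by
    refine Nat.sInf_mem (s := {L | TreeCut G ⟨fun _ => 0, 1⟩ L}) ?_
    obtain ⟨L, hL, -⟩ := h.exists_refutation
    exact ⟨L, Clause.toLine_empty (V := V) ▸ hL.treeCut⟩
  obtain ⟨t, h2, h3, h4⟩ := h1.exists_tree hS
  refine Nat.sInf_le ⟨t, ⟨?_, h3⟩, h4⟩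
  rw [h2]
  ext x
  simp [Line.Holds]

end Proofs

/-! ### The lower bound -/

section Lower

variable {V : Type} [Fintype V] [DecidableEq V] {m : ℕ} (dec : (Fin (ptrBits m) → Bool) → Fin m)

/-- The input of the composed problem with pointers `x`, written by `enc`, and vectors `y`. -/
def gadgetInput (enc : Fin m → Fin (ptrBits m) → Bool) (x : V → Fin m) (y : V × Fin m → Bool) :
    V × IndVar m → Bool
  | (v, Sum.inl j) => enc (x v) j
  | (v, Sum.inr p) => y (v, p)

variable {enc : Fin m → Fin (ptrBits m) → Bool}

theorem indGadget_gadgetInput (henc : ∀ p, dec (enc p) = p) (x : V → Fin m)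
    (y : V × Fin m → Bool) (v : V) :
    indGadget dec (fun w => gadgetInput enc x y (v, w)) = y (v, x v) := by
  have : (fun j => gadgetInput enc x y (v, Sum.inl j)) = enc (x v) := rfl
  rw [indGadget, this, henc]
  rfl

/-- Linearity separates pointer bits from vector cells. This is the only property of threshold
functions that the lower bound uses. -/
theorem exists_threshold_split {f : Set (V × IndVar m → Bool)} (hf : f ∈ thresholds (V × IndVar m))
    (enc : Fin m → Fin (ptrBits m) → Bool) :
    ∃ (A : (V → Fin m) → ℝ) (B : (V × Fin m → Bool) → ℝ) (t : ℝ), ∀ x y,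
      gadgetInput enc x y ∈ f ↔ t ≤ A x + B y := by
  obtain ⟨a, b, rfl⟩ := hf
  refine ⟨fun x => ∑ v, ∑ j, if enc (x v) j then a (v, Sum.inl j) else 0,
    fun y => ∑ v, ∑ p, if y (v, p) then a (v, Sum.inr p) else 0, b, fun x y => ?_⟩
  simp only [Set.mem_ofPred_eq, Fintype.sum_prod_type, Fintype.sum_sum_type,
    Finset.sum_add_distrib, gadgetInput]
  exact Iff.rfl

theorem pow_le_size_of_hard {F : CNF V} (hF : F.Unsat) (henc : ∀ p, dec (enc p) = p) {d q : ℕ}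
    {κ : ℝ} (hP : Params (Fin m) d q κ) {z : V → Bool} (hd0 : 0 < d)
    (hd : ¬ Solv F.search (d - 1) ∅ z) {t : FeasTree (V × IndVar m → Bool)}
    (ht : t.Solves (thresholds (V × IndVar m)) (F.search.comp (indGadget dec))) :
    (4 / 3 : ℝ) ^ q ≤ t.size := by
  have : Nonempty {D : Clause V // D ∈ F} := (hF z).elim fun D hD => ⟨⟨D, hD.1⟩⟩
  refine FeasTree.pow_le_size (𝓕 := thresholds (V × IndVar m))
    (S := F.search.comp (indGadget dec)) (fun r R => ∃ X Y I z k,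
      GoodRect (M := Fin m) F d q κ r X Y I z k ∧
        R = {u | ∃ x ∈ X, ∃ y ∈ Y, gadgetInput enc x y = u}) ?_ ?_ q _ t
      ⟨_, _, _, _, _, GoodRect.init hP hd hd0, rfl⟩ (by rw [ht.1]; exact Set.subset_univ _)
      (ht.2.validOn _)
  · rintro r R ⟨X, Y, I, z, k, hG, rfl⟩ f hf
    obtain ⟨A, B, b, hAB⟩ := exists_threshold_split hf enc
    obtain ⟨X', hX', Y', hY', ⟨I', z', k', hG'⟩, hc⟩ := hG.step hP A B b
    refine ⟨_, ?_, ⟨X', Y', I', z', k', hG', rfl⟩, ?_⟩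
    · rintro _ ⟨x, hx, y, hy, rfl⟩
      exact ⟨x, hX' hx, y, hY' hy, rfl⟩
    · rcases hc with hc | hc
      · left
        rintro _ ⟨x, hx, y, hy, rfl⟩
        exact (hAB x y).2 (hc x hx y hy)
      · right
        rintro _ ⟨x, hx, y, hy, rfl⟩
        exact fun h => hc x hx y hy ((hAB x y).1 h)
  · rintro r R ⟨X, Y, I, z, k, hG, rfl⟩ ⟨D, hD⟩
    obtain ⟨x, hx, y, hy, hxy⟩ := hG.exists_not_falsified hP hD
    refine ⟨_, ⟨x, hx, y, hy, rfl⟩, ?_⟩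
    simp only [SearchProblem.comp, indGadget_gadgetInput dec henc, CNF.search]
    exact hxy

/-- With constant pointers the composed problem contains the problem of `F` itself, so a single leaf
would give one clause falsified everywhere. This suffices for small `m`. -/
theorem two_le_size_of_hard {F : CNF V} (henc : ∀ p, dec (enc p) = p) (p : Fin m) {z : V → Bool}
    (hd : ¬ Solv F.search 0 ∅ z) {t : FeasTree (V × IndVar m → Bool)}
    (ht : t.Solves (thresholds (V × IndVar m)) (F.search.comp (indGadget dec))) :
    2 ≤ t.size := by
  obtain ⟨h1, h2⟩ := ht
  cases t with
  | leaf f =>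
    obtain ⟨-, o, ho⟩ := h2
    refine absurd ⟨o, fun x _ => ?_⟩ hd
    have := ho (gadgetInput enc (fun _ => p) fun a => x a.1)
      (by rw [show f = Set.univ from h1]; trivial)
    simpa only [SearchProblem.comp, indGadget_gadgetInput dec henc] using this
  | node₁ f t => have := t.one_le_size; simp only [FeasTree.size]; omega
  | node₂ f t₁ t₂ => have := t₁.one_le_size; simp only [FeasTree.size]; omega

end Lower

/-! ### Numerical estimates -/

theorem two_rpow_logb {m : ℕ} (hm : 2 ≤ m) : (2 : ℝ) ^ Real.logb 2 m = m :=
  Real.rpow_logb (by norm_num) (by norm_num) (by exact_mod_cast (by omega : 0 < m))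

theorem one_le_logb {m : ℕ} (hm : 2 ≤ m) : 1 ≤ Real.logb 2 m := by
  rw [Real.le_logb_iff_rpow_le (by norm_num) (by exact_mod_cast (by omega : 0 < m)),
    Real.rpow_one]
  exact_mod_cast hm

theorem ptrBits_le {m : ℕ} (hm : 2 ≤ m) : (ptrBits m : ℝ) ≤ Real.logb 2 m + 1 := by
  have h := Real.natCeil_logb_natCast 2 m
  rw [Nat.cast_ofNat] at h
  rw [ptrBits, ← h]
  exact (Nat.ceil_lt_add_one (by linarith [one_le_logb hm])).le

theorem ptrBits_add_one_le {m : ℕ} (hm : 2 ≤ m) : ((ptrBits m + 1 : ℕ) : ℝ) ≤ 6 * Real.log m := by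
  have h1 := ptrBits_le hm
  have h2 := one_le_logb hm
  have h3 : Real.logb 2 m ≤ 2 * Real.log m := by
    rw [Real.logb, div_le_iff₀ (Real.log_pos (by norm_num))]
    have h4 := Real.log_two_gt_d9
    have h5 : 0 ≤ Real.log m := Real.log_natCast_nonneg m
    nlinarith
  push_cast
  linarith

theorem le_rpow_of_size_le {m d s : ℕ} (hm : 2 ≤ m)
    (h : s + 1 ≤ 2 ^ (d * (ptrBits m + 1) + 1)) : (s : ℝ) ≤ (m : ℝ) ^ (6 * (d : ℝ)) := by
  rcases Nat.eq_zero_or_pos d with rfl | hd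
  · have : s ≤ 1 := by simpa using h
    simpa using this
  have h1 := ptrBits_le hm
  have h2 := one_le_logb hm
  have hd1 : (1 : ℝ) ≤ d := by exact_mod_cast hd
  have h3 : (s : ℝ) ≤ (2 : ℝ) ^ (d * (ptrBits m + 1) + 1) := by
    exact_mod_cast (Nat.le_succ s).trans h
  refine h3.trans ?_
  rw [← two_rpow_logb hm, ← Real.rpow_natCast, ← Real.rpow_mul (by norm_num)]
  refine Real.rpow_le_rpow_of_exponent_le (by norm_num) ?_
  push_cast
  nlinarith

/-- Here `log₂ m ≤ 100` and `D ≤ 2`, so the exponent of 2 is at most `100 · 2 / 200`. -/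
theorem rpow_le_of_small {m : ℕ} (hm : 2 ≤ m) (hs : (m : ℝ) ≤ 2 ^ 100) {D : ℝ} (hD0 : 0 ≤ D)
    (hD : D ≤ (m : ℝ) ^ (1 / 1000 : ℝ)) : (m : ℝ) ^ (1 / 200 * D) ≤ 2 := by
  have hL : Real.logb 2 m ≤ 100 := by
    rw [Real.logb_le_iff_le_rpow (by norm_num) (by exact_mod_cast (by omega : 0 < m))]
    exact_mod_cast hs
  have hL1 := one_le_logb hm
  have hD2 : D ≤ 2 := by
    refine hD.trans ?_
    rw [← two_rpow_logb hm, ← Real.rpow_mul (by norm_num)]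
    calc (2 : ℝ) ^ (Real.logb 2 m * (1 / 1000)) ≤ 2 ^ (1 : ℝ) :=
          Real.rpow_le_rpow_of_exponent_le (by norm_num) (by linarith)
      _ = 2 := Real.rpow_one 2
  rw [← two_rpow_logb hm, ← Real.rpow_mul (by norm_num)]
  calc (2 : ℝ) ^ (Real.logb 2 m * (1 / 200 * D)) ≤ 2 ^ (1 : ℝ) :=
        Real.rpow_le_rpow_of_exponent_le (by norm_num) (by nlinarith)
    _ = 2 := Real.rpow_one 2

/-- Bounding the logarithm by `20 m ^ (1 / 10)` puts `q²` at order `m ^ 0.202`; the remaining `m ^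
0.298 ≥ 2 ^ 29` absorbs the constants. -/
theorem sqrt_large {m : ℕ} (hm : 2 ≤ m) (hs : (2 : ℝ) ^ 100 ≤ m) {q : ℕ}
    (hq : (q : ℝ) ≤ (m : ℝ) ^ (1 / 1000 : ℝ) * Real.logb 2 m) :
    400 * (3 * q + 1) * (q + 1) ≤ √(m : ℝ) := by
  have hm0 : (0 : ℝ) < m := by exact_mod_cast (by omega : 0 < m)
  have hm1 : (1 : ℝ) ≤ m := by exact_mod_cast (by omega : 1 ≤ m)
  have hL1 := one_le_logb hm
  have hL : Real.logb 2 m ≤ 20 * (m : ℝ) ^ (1 / 10 : ℝ) := by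
    have h1 := Real.log_le_rpow_div hm0.le (by norm_num : (0 : ℝ) < 1 / 10)
    rw [Real.logb, div_le_iff₀ (Real.log_pos (by norm_num))]
    have h2 := Real.log_two_gt_d9
    have h3 : (0 : ℝ) ≤ (m : ℝ) ^ (1 / 10 : ℝ) := by positivity
    nlinarith
  have hA1 : (1 : ℝ) ≤ (m : ℝ) ^ (1 / 1000 : ℝ) := Real.one_le_rpow hm1 (by norm_num)
  set B := (m : ℝ) ^ (1 / 1000 : ℝ) * Real.logb 2 m with hB
  have hB1 : 1 ≤ B := by nlinarith
  have hBle : B ≤ 20 * (m : ℝ) ^ (101 / 1000 : ℝ) := by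
    have : (m : ℝ) ^ (101 / 1000 : ℝ) = (m : ℝ) ^ (1 / 1000 : ℝ) * (m : ℝ) ^ (1 / 10 : ℝ) := by
      rw [← Real.rpow_add hm0]; norm_num
    rw [this, hB]
    nlinarith
  have hq0 : (0 : ℝ) ≤ q := by positivity
  have h1 : 400 * (3 * (q : ℝ) + 1) * (q + 1) ≤ 4800 * B ^ 2 := by nlinarith
  have h2 : B ^ 2 ≤ 400 * (m : ℝ) ^ (202 / 1000 : ℝ) := by
    have : (m : ℝ) ^ (202 / 1000 : ℝ) = ((m : ℝ) ^ (101 / 1000 : ℝ)) ^ 2 := by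
      rw [← Real.rpow_natCast, ← Real.rpow_mul hm0.le]; norm_num
    rw [this]
    nlinarith
  have h3 : (2 : ℝ) ^ 29 ≤ (m : ℝ) ^ (298 / 1000 : ℝ) := by
    calc (2 : ℝ) ^ 29 = ((2 : ℝ) ^ 100) ^ (29 / 100 : ℝ) := by
          rw [← Real.rpow_natCast 2 100, ← Real.rpow_mul (by norm_num), ← Real.rpow_natCast]
          norm_num
      _ ≤ (m : ℝ) ^ (29 / 100 : ℝ) := Real.rpow_le_rpow (by norm_num) hs (by norm_num)
      _ ≤ _ := Real.rpow_le_rpow_of_exponent_le hm1 (by norm_num)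
  have h4 : √(m : ℝ) = (m : ℝ) ^ (298 / 1000 : ℝ) * (m : ℝ) ^ (202 / 1000 : ℝ) := by
    rw [Real.sqrt_eq_rpow, ← Real.rpow_add hm0]; norm_num
  have h5 : (0 : ℝ) ≤ (m : ℝ) ^ (202 / 1000 : ℝ) := by positivity
  rw [h4]
  nlinarith

theorem exists_params {m d : ℕ} (hm : 2 ≤ m) (hs : (2 : ℝ) ^ 100 ≤ m) (hd : 0 < d) :
    ∃ q κ, Params (Fin m) d q κ ∧
      (m : ℝ) ^ (1 / 200 * min (d : ℝ) ((m : ℝ) ^ (1 / 1000 : ℝ))) ≤ (4 / 3 : ℝ) ^ q := by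
  have hm0 : (0 : ℝ) < m := by exact_mod_cast (by omega : 0 < m)
  have hm1 : (1 : ℝ) ≤ m := by exact_mod_cast (by omega : 1 ≤ m)
  have hd1 : (1 : ℝ) ≤ d := by exact_mod_cast hd
  set D := min (d : ℝ) ((m : ℝ) ^ (1 / 1000 : ℝ)) with hD
  set L := Real.logb 2 m with hL
  have hD1 : 1 ≤ D := le_min hd1 (Real.one_le_rpow hm1 (by norm_num))
  have hL100 : 100 ≤ L := by
    rw [hL, Real.le_logb_iff_rpow_le (by norm_num) hm0]
    exact_mod_cast hs
  have hDd : D ≤ d := min_le_left _ _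
  have hDm : D ≤ (m : ℝ) ^ (1 / 1000 : ℝ) := min_le_right _ _
  have hx : 0 ≤ D * L / 8 := by positivity
  -- Then `4 ^ q ≤ 2 ^ (DL / 4)` lies below `κ ^ d = 2 ^ (dL / 2)`, while `DL ≥ 100` makes the
  -- rounding harmless: `q / 4 ≥ DL / 200`.
  set q := ⌊D * L / 8⌋₊ with hq
  have hq1 : (q : ℝ) ≤ D * L / 8 := Nat.floor_le hx
  have hq2 : D * L / 8 < q + 1 := Nat.lt_floor_add_one _
  have hDL : 100 ≤ D * L := by nlinarith
  have hmL : (m : ℝ) = 2 ^ L := (two_rpow_logb hm).symm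
  refine ⟨q, √(m : ℝ), ⟨?_, ?_, ?_⟩, ?_⟩
  · rw [Real.sq_sqrt hm0.le, Fintype.card_fin]
  · refine sqrt_large hm hs (hq1.trans ?_)
    rw [← hL]
    nlinarith
  · have h1 : (4 : ℝ) ^ q = 2 ^ (2 * q : ℝ) := by
      rw [Real.rpow_mul (by norm_num), Real.rpow_natCast]; norm_num
    have h2 : √(m : ℝ) ^ d = 2 ^ (L * (1 / 2) * d) := by
      rw [Real.sqrt_eq_rpow, Real.rpow_mul (by norm_num), Real.rpow_mul (by norm_num), ← hmL,
        Real.rpow_natCast]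
    rw [h1, h2]
    refine Real.rpow_lt_rpow_of_exponent_lt (by norm_num) ?_
    nlinarith
  · have h1 : (2 : ℝ) ^ (1 / 4 : ℝ) ≤ 4 / 3 := by
      rw [one_div, Real.rpow_inv_le_iff_of_pos (by norm_num) (by norm_num) (by norm_num)]
      norm_num
    calc (m : ℝ) ^ (1 / 200 * D) = 2 ^ (L * (1 / 200 * D)) := by
          rw [Real.rpow_mul two_pos.le L, ← hmL]
      _ ≤ 2 ^ (1 / 4 * (q : ℝ)) :=
          Real.rpow_le_rpow_of_exponent_le (by norm_num) (by nlinarith)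
      _ = ((2 : ℝ) ^ (1 / 4 : ℝ)) ^ q := by rw [Real.rpow_mul (by norm_num), Real.rpow_natCast]
      _ ≤ _ := pow_le_pow_left₀ (by positivity) h1 q

/-- The lower bound for LTF-trees solving the composed problem. -/
theorem rpow_le_ltfTree {m : ℕ} (hm : 2 ≤ m) {dec : (Fin (ptrBits m) → Bool) → Fin m}
    (hdec : Function.Surjective dec) {V : Type} [Fintype V] [DecidableEq V] {F : CNF V}
    (hF : F.Unsat) {t : FeasTree (V × IndVar m → Bool)}
    (ht : t.Solves (thresholds (V × IndVar m)) (F.search.comp (indGadget dec))) :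
    (m : ℝ) ^ (1 / 200 * min (decDepth F.search : ℝ) ((m : ℝ) ^ (1 / 1000 : ℝ))) ≤ t.size := by
  obtain ⟨enc, henc⟩ := hdec.hasRightInverse
  rcases Nat.eq_zero_or_pos (decDepth F.search) with h0 | hpos
  · rw [h0, Nat.cast_zero, min_eq_left (by positivity), mul_zero, Real.rpow_zero]
    exact_mod_cast t.one_le_size
  have hhard : ¬ Solv F.search (decDepth F.search - 1) ∅ fun _ => false := by
    intro h
    have := h.decDepth_le
    omega
  rcases le_total (m : ℝ) (2 ^ 100) with hs | hs
  · refine (rpow_le_of_small hm hs (by positivity) (min_le_right _ _)).trans ?_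
    exact_mod_cast two_le_size_of_hard dec henc ⟨0, by omega⟩
      (fun h => hhard (h.mono_depth (Nat.zero_le _))) ht
  · obtain ⟨q, κ, hP, hle⟩ := exists_params hm hs hpos
    exact hle.trans (pow_le_size_of_hard dec hF henc hP hpos hhard ht)

end LiftCP

/-! ### Assembly of the two chains -/

theorem theorem6 :
    ∃ c C : ℝ, 0 < c ∧ 0 < C ∧
      ∀ (m : ℕ), 2 ≤ m →
      ∀ (dec : (Fin (ptrBits m) → Bool) → Fin m), Function.Surjective dec →
        (queryComplexity (indGadget dec) : ℝ) ≤ C * Real.log m ∧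
        ∀ (n : ℕ) (F : CNF (Fin n)), F.Unsat →
          ((m : ℝ) ^ (c * min (decDepth F.search : ℝ) ((m : ℝ) ^ (1 / 1000 : ℝ)))
              ≤ (ltfTree (F.search.comp (indGadget dec)) : ℝ) ∧
            ltfTree (F.search.comp (indGadget dec))
              ≤ decTree (F.search.comp (indGadget dec)) ∧
            (decTree (F.search.comp (indGadget dec)) : ℝ)
              ≤ (m : ℝ) ^ (C * (decDepth F.search : ℝ))) ∧
          ((m : ℝ) ^ (c * min (decDepth F.search : ℝ) ((m : ℝ) ^ (1 / 1000 : ℝ)))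
              ≤ (cutTree (F.compInd dec) : ℝ) ∧
            cutTree (F.compInd dec) ≤ resTree (F.compInd dec) ∧
            (resTree (F.compInd dec) : ℝ) ≤ (m : ℝ) ^ (C * (decDepth F.search : ℝ))) := by
  refine ⟨1 / 200, 6, by norm_num, by norm_num, fun m hm dec hdec => ⟨?_, fun n F hF => ?_⟩⟩
  · refine le_trans ?_ (ptrBits_add_one_le hm)
    exact_mod_cast queryComplexity_indGadget_le dec
  have hG : Solv (F.compInd dec).search (decDepth F.search * (ptrBits m + 1)) ∅
      fun _ => false := by
    simpa [readVars] using Solv.compInd dec (hF.solv_decDepth fun _ => indGadget dec fun _ => false)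
      (fun _ => false) (by simp)
  have hcl : ∀ E ∈ F.compInd dec, ∃ o : {D // D ∈ F}, ∀ u, Clause.Falsified E u →
      F.search.comp (indGadget dec) u o := by
    intro E hE
    obtain ⟨D, hD, p, rfl⟩ := (CNF.mem_compInd dec).1 hE
    exact ⟨⟨D, hD⟩, fun u hu => Clause.falsified_of_liftInd dec hu⟩
  choose e he using hcl
  have hS : Solv (F.search.comp (indGadget dec)) (decDepth F.search * (ptrBits m + 1)) ∅
      fun _ => false :=
    hG.map_output (fun E => e E.1 E.2) fun x E hx => he E.1 E.2 x hx
  have hne : Nonempty {D // D ∈ F} := (hF fun _ => false).elim fun D hD => ⟨⟨D, hD.1⟩⟩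
  have hlow : (m : ℝ) ^ (1 / 200 * min (decDepth F.search : ℝ) ((m : ℝ) ^ (1 / 1000 : ℝ))) ≤
      (ltfTree (F.search.comp (indGadget dec)) : ℝ) := by
    -- The infimum of the empty set is 0, so a tree must exist before a bound on all trees bounds
    -- `ltfTree`.
    obtain ⟨t, ht, hts⟩ := Nat.sInf_mem (s := {s | ∃ t : FeasTree (Fin n × IndVar m → Bool),
      t.Solves (thresholds (Fin n × IndVar m)) (F.search.comp (indGadget dec)) ∧ t.size = s})
      (hS.exists_decTree.imp' FeasTree.size fun t ht =>
        ⟨t, ⟨ht.1.1, ht.1.2.mono_family conjunctions_subset_thresholds⟩, rfl⟩)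
    rw [ltfTree, ← hts]
    exact rpow_le_ltfTree hm hdec hF ht
  have hcut : ltfTree (F.search.comp (indGadget dec)) ≤ cutTree (F.compInd dec) :=
    ltfTree_le_cutTree (fun E hE => ⟨e E hE, he E hE⟩) hG
  exact ⟨⟨hlow, ltfTree_le_decTree hS, le_rpow_of_size_le hm hS.decTree_le⟩,
    hlow.trans (by exact_mod_cast hcut), cutTree_le_resTree hG,
    le_rpow_of_size_le hm hG.resTree_le⟩
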